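/- **Notation.** Let $E,F$ be finite-dimensional real normed spaces. For a sequence $w=(w_i)_{i\in\mathbb Z}$ put $\|w\|=\sup_i\|w_i\|\in[0,\infty]$, $(Lw)_k=w_{k+1}$ and $(\Delta w)_k=w_{k+1}-w_k$. For finitely supported $\alpha,\beta:\mathbb Z\to\mathbb R$ put $(S_\alpha c)_k=\sum_l\alpha_{k-2l}c_l$ and $(D_\beta c)_k=\sum_l\beta_{l-2k}c_l$. The linear rule $S_\alpha$ is *convergent* if for every bounded $c:\mathbb Z\to\mathbb R$ there is a continuous $f:\mathbb R\to\mathbb R$ with $\sup_k|(S_\alpha^jc)_k-f(2^{-j}k)|\to0$ as $j\to\infty$, and $f\neq0$ for some such $c$. **Coordinate setting.** Let $V\subseteq E$, $W\subseteq F$ be open (for instance $V=E$, $W=F$), and let $\oplus:V\times W\to E$, $\ominus:V\times V\to W$ be $C^2$ maps with $p\oplus(q\ominus p)=q$ and $A\|p-q\|\le\|p\ominus q\|\le B\|p-q\|$ for all $p,q\in V$, with constants $A>0$ and $B$. They are applied to sequences entrywise. Let $\mathcal S,\mathcal D$ map $V$-valued sequences to $E$-valued sequences, and let $\mathcal Q,\mathcal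 R$ map $W$-valued sequences to $W$-valued sequences. All four are local and of class $C^2$ (each entry of the output is a $C^2$ function of finitely many entries of the input) and satisfy $\mathcal SL=L^2\mathcal S$, $\mathcal RL=L^2\mathcal R$, $\mathcal DL^2=L\mathcal D$, $\mathcal QL^2=L\mathcal Q$. **Assumptions on the operators.** 1. (Nonlinear quadrature mirror filter equation) $\mathcal S\mathcal Dc\oplus\mathcal R\mathcal Q(c\ominus\mathcal S\mathcal Dc)=c$ for all $V$-valued $c$ such that $\mathcal Dc$ and $\mathcal S\mathcal Dc$ are $V$-valued. 2. (Boundedness) There is a constant $C$ with $\|\mathcal Qw\|,\|\mathcal Rw\|\le C\|w\|$ for all $W$-valued $w$. 3. (Reproduction of constants) $\mathcal Sc=c$ and $\mathcal Dc=c$ for every constant $V$-valued sequence $c$. 4. (First-order linearity on constant data) There is a $\beta$ such that at every constant $V$-valued sequence $c$ the Fréchet differential of $\mathcal D$ with respect to the sup norm is $d\mathcal D|_c=D_\beta$. Moreover, either there is an $\alpha$ with $S_\alpha$ convergent such that $d\mathcal S|_c=S_\alpha$ at every constant $V$-valued sequence $c$, or (Haar case) $\mathcal S$ is the splitting rule $(\mathcal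 Sc)_{2k}=(\mathcal Sc)_{2k+1}=c_k$. **Data.** Let $(c^{(j)})_{j\ge0}$ be a data pyramid with $c^{(j-1)}=\mathcal Dc^{(j)}$ for $j\ge 1$, such that all entries of all $c^{(j)}$ and of all $\mathcal Sc^{(j)}$ lie in one compact subset of $V$, and such that for some $\mu\in[0,1)$ and some constant $C'$, $\|\Delta c^{(j)}\|\le C'\mu^j$ for all $j\ge 0$. Let $d^{(k)}=\mathcal Q(c^{(k)}\ominus\mathcal S\mathcal Dc^{(k)})$, $k\ge1$, be its detail coefficients. Extend $\oplus,\mathcal S,\mathcal R$ arbitrarily to all of $E\times F$ and to all $E$-valued, respectively $F$-valued, sequences, so that reconstruction is always defined. **Theorem.** Reconstruction from coarse data and details is Lipschitz stable, uniformly in the level: there are a constant $M\geq 0$ and constants $E_1,E_2>0$ such that for every $j\ge0$ and all perturbed coarse data $\widetilde c^{(0)}$ and details $\widetilde d^{(1)},\dots,\widetilde d^{(j)}$ with reconstructed data $\widetilde c^{(k)}=\mathcal S\widetilde c^{(k-1)}\oplus\mathcal R\widetilde d^{(k)}$ $(1\le k\le j)$, $$\|c^{(0)}-\widetilde c^{(0)}\|\le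 E_1,\quad \|d^{(k)}-\widetilde d^{(k)}\|\le E_2\,\mu^k\ \ (1\le k\le j)$$ implies $$\|c^{(j)}-\widetilde c^{(j)}\|\le M\Big(\|c^{(0)}-\widetilde c^{(0)}\|+\sum_{k=1}^j\|d^{(k)}-\widetilde d^{(k)}\|\Big).$$ -/

import Mathlib

open Filter Topology
open scoped NNReal ENNReal

namespace Multiscale

/-- The sup norm `‖w‖ = sup_i ‖w_i‖` of a sequence, with value `∞` on unbounded sequences. -/
noncomputable def seqNorm {E : Type*} [NormedAddCommGroup E] (w : ℤ → E) : ℝ≥0∞ :=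
  ⨆ i, ‖w i‖ₑ

/-- The left shift `(L c)_k = c_{k+1}`. -/
def shift {E : Type*} (c : ℤ → E) : ℤ → E := fun k => c (k + 1)

/-- Forward differences `(Δ c)_k = c_{k+1} - c_k`. -/
def fwdDiffSeq {E : Type*} [Sub E] (c : ℤ → E) : ℤ → E := fun k => c (k + 1) - c k

/-- The sequence `c` takes all its values in `U`. -/
def ValuedIn {E : Type*} (U : Set E) (c : ℤ → E) : Prop := ∀ k, c k ∈ U

/-- On `U`-valued sequences, every component of `T c` is a `C²` function of finitely many
entries of `c` (locality and smoothness). The window is `c_{-m}, …, c_m`. -/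
def IsLocalSmooth {E : Type*} [NormedAddCommGroup E] [NormedSpace ℝ E]
    (U : Set E) (T : (ℤ → E) → ℤ → E) : Prop :=
  ∀ k : ℤ, ∃ (m : ℕ) (φ : (Fin (2 * m + 1) → E) → E),
    ContDiffOn ℝ 2 φ (Set.univ.pi fun _ => U) ∧
    ∀ c, ValuedIn U c → T c k = φ (fun i => c ((i : ℤ) - (m : ℤ)))

/-- A smooth local (nonlinear) upscaling operator on `U`-valued sequences: `T L = L² T`. -/
structure IsUpscaling {E : Type*} [NormedAddCommGroup E] [NormedSpace ℝ E]
    (U : Set E) (T : (ℤ → E) → ℤ → E) : Prop where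
  localSmooth : IsLocalSmooth U T
  shift_comm : ∀ c, ValuedIn U c → T (shift c) = shift (shift (T c))

/-- A smooth local (nonlinear) downscaling operator on `U`-valued sequences: `T L² = L T`. -/
structure IsDownscaling {E : Type*} [NormedAddCommGroup E] [NormedSpace ℝ E]
    (U : Set E) (T : (ℤ → E) → ℤ → E) : Prop where
  localSmooth : IsLocalSmooth U T
  shift_comm : ∀ c, ValuedIn U c → T (shift (shift c)) = shift (T c)

/-- The linear upscaling rule `(S_α c)_k = ∑_l α_{k-2l} c_l` of a finite filter `α`. -/
noncomputable def upscale {E : Type*} [AddCommGroup E] [Module ℝ E]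
    (α : ℤ →₀ ℝ) (c : ℤ → E) : ℤ → E :=
  fun k => ∑ᶠ l : ℤ, α (k - 2 * l) • c l

/-- The linear downscaling rule `(D_β c)_k = ∑_l β_{l-2k} c_l` of a finite filter `β`. -/
noncomputable def downscale {E : Type*} [AddCommGroup E] [Module ℝ E]
    (β : ℤ →₀ ℝ) (c : ℤ → E) : ℤ → E :=
  fun k => ∑ᶠ l : ℤ, β (l - 2 * k) • c l

/-- `f` is the uniform limit of the iterates `S_α^j c`, the `k`-th entry at level `j` being
placed at the parameter `k / 2^j`. -/
def IsSubdivisionLimit (α : ℤ →₀ ℝ) (c : ℤ → ℝ) (f : ℝ → ℝ) : Prop :=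
  Continuous f ∧
    Tendsto (fun j : ℕ => seqNorm fun k : ℤ => (upscale α)^[j] c k - f ((k : ℝ) / 2 ^ j))
      atTop (𝓝 0)

/-- Convergence of the linear subdivision rule `S_α`: bounded data have continuous limits, and
not all of these limits vanish. -/
def IsConvergentSubdivision (α : ℤ →₀ ℝ) : Prop :=
  (∀ c : ℤ → ℝ, seqNorm c < ∞ → ∃ f, IsSubdivisionLimit α c f) ∧
    ∃ c f, seqNorm c < ∞ ∧ IsSubdivisionLimit α c f ∧ f ≠ 0

/-- `T' = dT|_c`: Fréchet differentiability of `T` at the sequence `c`, with respect to the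
sup norm, with differential `T'` (in use, `T'` is one of the linear rules above). -/
def HasSeqDifferentialAt {E : Type*} [NormedAddCommGroup E]
    (T T' : (ℤ → E) → ℤ → E) (c : ℤ → E) : Prop :=
  ∀ ε : ℝ≥0, 0 < ε → ∃ δ : ℝ≥0, 0 < δ ∧ ∀ h : ℤ → E, seqNorm h ≤ δ →
    seqNorm (T (c + h) - T c - T' h) ≤ ε * seqNorm h

/-- The splitting rule `(…, c_0, c_0, c_1, c_1, …)` of the Haar scheme. -/
def IsSplittingRule {E : Type*} (U : Set E) (S : (ℤ → E) → ℤ → E) : Prop :=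
  ∀ c, ValuedIn U c → ∀ k, S c (2 * k) = c k ∧ S c (2 * k + 1) = c k

/-- The operator is bounded on `U`-valued sequences: `‖T w‖ ≲ ‖w‖`. -/
def IsBoundedRule {F : Type*} [NormedAddCommGroup F]
    (U : Set F) (T : (ℤ → F) → ℤ → F) : Prop :=
  ∃ C : ℝ≥0, ∀ w, ValuedIn U w → seqNorm (T w) ≤ C * seqNorm w

/-- Entrywise `c ⊖ b`. -/
def seqSub {E F : Type*} (sub : E → E → F) (c b : ℤ → E) : ℤ → F := fun k => sub (c k) (b k)

/-- Entrywise `b ⊕ w`. -/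
def seqAdd {E F : Type*} (add : E → F → E) (b : ℤ → E) (w : ℤ → F) : ℤ → E :=
  fun k => add (b k) (w k)

/-- The detail coefficients `d = Q (c ⊖ S D c)` of data `c`. -/
def detail {E F : Type*} (sub : E → E → F) (S D : (ℤ → E) → ℤ → E) (Q : (ℤ → F) → ℤ → F)
    (c : ℤ → E) : ℤ → F :=
  Q (seqSub sub c (S (D c)))

/-- Coordinate representations `⊕ : V × W → E`, `⊖ : V × V → W` (`add p v = p ⊕ v` and
`sub q p = q ⊖ p`) on open sets `V`, `W`. -/
structure IsPointVectorPair {E F : Type*} [NormedAddCommGroup E] [NormedSpace ℝ E]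
    [NormedAddCommGroup F] [NormedSpace ℝ F]
    (V : Set E) (W : Set F) (add : E → F → E) (sub : E → E → F) : Prop where
  isOpen_points : IsOpen V
  isOpen_vectors : IsOpen W
  smooth_add : ContDiffOn ℝ 2 (fun x : E × F => add x.1 x.2) (V ×ˢ W)
  smooth_sub : ContDiffOn ℝ 2 (fun x : E × E => sub x.1 x.2) (V ×ˢ V)
  sub_mem : ∀ p ∈ V, ∀ q ∈ V, sub q p ∈ W
  add_sub : ∀ p ∈ V, ∀ q ∈ V, add p (sub q p) = q
  lipschitz : ∃ A B : ℝ, 0 < A ∧ ∀ p ∈ V, ∀ q ∈ V,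
    A * ‖p - q‖ ≤ ‖sub p q‖ ∧ ‖sub p q‖ ≤ B * ‖p - q‖

/-- The nonlinear quadrature mirror filter equation `S D c ⊕ R Q (c ⊖ S D c) = c`, for all
data for which the left-hand side is defined. -/
def IsQMF {E F : Type*} (V : Set E) (add : E → F → E) (sub : E → E → F)
    (S D : (ℤ → E) → ℤ → E) (Q R : (ℤ → F) → ℤ → F) : Prop :=
  ∀ c, ValuedIn V c → ValuedIn V (D c) → ValuedIn V (S (D c)) →
    seqAdd add (S (D c)) (R (Q (seqSub sub c (S (D c))))) = c

/-- The operator reproduces constant sequences with value in `V`. -/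
def ReproducesConstants {E : Type*} (V : Set E) (T : (ℤ → E) → ℤ → E) : Prop :=
  ∀ x ∈ V, T (fun _ => x) = fun _ => x

end Multiscale

/-! By the quadrature mirror filter equation the pyramid is itself reconstructed from its own
details, so the theorem is about how the error `e k = c k - c' k` propagates through one
reconstruction step. Let `T` be the linear rule `S_α` (or the splitting rule). The step acts on
errors as `T` up to small terms, for three reasons. Since `S` and `D` fix constants, slowly varying
data are well predicted, and the details of level `k` are `O(μ ^ k)` (`exists_detail_estimate`).
Since `p ⊕ 0 = p`, adding a small vector is nearly a translation
(`IsPointVectorPair.exists_add_estimate`). Since `S` is `C²` with the same differential `T` at all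
constants, `S b - S b'` differs from `T (b - b')` by at most a multiple of `(‖Δb‖ + ‖Δ(b - b')‖) ‖b
- b'‖` (`exists_linearization_entry`). `exists_fine_step` combines them.

The term `Δ(b - b')` is the obstacle, because nothing is known about differences of the perturbed
data. It is overcome because `T` damps differences: convergence of `S_α` bounds the powers of `T`
and, with reproduction of constants, makes some power of `T` halve differences. Hence there are a
norm `p` which `T` does not increase and a seminorm `q` dominating differences which `T` contracts
(`exists_adaptedNorms_of_halving`). In the Haar case `S` equals `T` and `q = 0` suffices.

With `a = p (e k)` and `b = q (e k)` this gives two coupled inequalities. As long as `a` is small,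
the `b`'s are summable, so the product of the growth factors `1 + C (μ ^ k + b)` stays bounded, and
this in turn keeps `a` small (`coupled_gronwall`). The finitely many levels where `μ ^ k` is not yet
small need only a crude Lipschitz bound (`finite_steps_stable`); `stable_of_steps` joins the two
ranges. -/

namespace Multiscale

/-! ### Sup norms and differences of sequences. -/

section SeqNorm

variable {E : Type*} [NormedAddCommGroup E]

theorem seqNorm_le_ofReal_iff {w : ℤ → E} {a : ℝ} (ha : 0 ≤ a) :
    seqNorm w ≤ ENNReal.ofReal a ↔ ∀ i, ‖w i‖ ≤ a := by
  simp only [seqNorm, iSup_le_iff, ← ofReal_norm, ENNReal.ofReal_le_ofReal_iff ha]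

theorem norm_le_toReal_seqNorm {w : ℤ → E} (hw : seqNorm w ≠ ∞) (i : ℤ) :
    ‖w i‖ ≤ (seqNorm w).toReal := by
  refine (seqNorm_le_ofReal_iff ENNReal.toReal_nonneg).1 ?_ i
  rw [ENNReal.ofReal_toReal hw]

/-- Entries of a sequence with small differences are close to each other. -/
theorem norm_sub_le_of_fwdDiffSeq_le {c : ℤ → E} {η : ℝ} (h : ∀ i, ‖fwdDiffSeq c i‖ ≤ η)
    (n : ℕ) (k l : ℤ) (hkl : |l - k| ≤ n) : ‖c l - c k‖ ≤ n * η := by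
  have hη : 0 ≤ η := (norm_nonneg _).trans (h 0)
  have up : ∀ (m : ℕ) (k : ℤ), ‖c (k + m) - c k‖ ≤ m * η := by
    intro m
    induction m with
    | zero => intro k; simp
    | succ m ih =>
      intro k
      have e : c (k + (m + 1 : ℕ)) - c k = fwdDiffSeq c (k + m) + (c (k + m) - c k) := by
        simp only [fwdDiffSeq]; push_cast; rw [← add_assoc]; abel
      rw [e]
      refine (norm_add_le _ _).trans ?_
      have := h (k + m); have := ih k
      push_cast; linarith
  have key : ∀ k l : ℤ, k ≤ l → |l - k| ≤ n → ‖c l - c k‖ ≤ n * η := by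
    intro k l h1 h2
    obtain ⟨m, rfl⟩ := Int.le.dest h1
    have hm : (m : ℝ) ≤ n := by
      have : (m : ℤ) ≤ n := by simpa using h2
      exact_mod_cast this
    exact (up m k).trans (mul_le_mul_of_nonneg_right hm hη)
  rcases le_total k l with h1 | h1
  · exact key k l h1 hkl
  · rw [norm_sub_rev]; exact key l k h1 (by rwa [abs_sub_comm])

end SeqNorm

/-! ### Linear subdivision: iterates, impulse responses, decay of differences. -/

section Upscale

variable {E : Type*} [NormedAddCommGroup E] [NormedSpace ℝ E] (α : ℤ →₀ ℝ)

theorem upscale_support_finite (c : ℤ → E) (k : ℤ) :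
    (Function.support fun l : ℤ => α (k - 2 * l) • c l).Finite := by
  refine (α.hasFiniteSupport.preimage (f := fun l : ℤ => k - 2 * l) ?_).subset ?_
  · intro a _ b _ h; simp only at h; omega
  · intro l hl h0
    exact hl (by simp only [Function.mem_support] at *; simp [h0])

theorem upscale_add (c d : ℤ → E) : upscale α (c + d) = upscale α c + upscale α d := by
  funext k
  simp only [upscale, Pi.add_apply, smul_add]
  exact finsum_add_distrib (upscale_support_finite α c k) (upscale_support_finite α d k)

theorem upscale_smul (t : ℝ) (c : ℤ → E) : upscale α (t • c) = t • upscale α c := by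
  funext k
  simp only [upscale, Pi.smul_apply]
  rw [smul_finsum]
  exact finsum_congr fun l => smul_comm _ _ _

theorem upscale_smul_const (a : ℤ → ℝ) (x : E) :
    upscale α (fun k => a k • x) = fun k => upscale α a k • x := by
  funext k
  simp only [upscale]
  rw [finsum_smul]
  exact finsum_congr fun l => by rw [smul_eq_mul, mul_smul]

theorem upscale_translate (c : ℤ → E) (n : ℤ) :
    upscale α (fun k => c (k - n)) = fun k => upscale α c (k - 2 * n) := by
  funext k
  simp only [upscale]
  rw [← finsum_comp_equiv (Equiv.addRight n)]
  exact finsum_congr fun l => by simp only [Equiv.coe_addRight]; congr 2 <;> ring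

theorem exists_abs_bound : ∃ N : ℕ, ∀ i : ℤ, (N : ℤ) < |i| → α i = 0 := by
  refine ⟨α.support.sup Int.natAbs, fun i hi => ?_⟩
  by_contra h
  have := Finset.le_sup (f := Int.natAbs) (Finsupp.mem_support_iff.2 h)
  rw [Int.abs_eq_natAbs] at hi
  omega

variable {α}

theorem upscale_congr {N : ℕ} (hN : ∀ i : ℤ, (N : ℤ) < |i| → α i = 0) {c d : ℤ → E} {k : ℤ}
    (h : ∀ l, |k - 2 * l| ≤ N → c l = d l) : upscale α c k = upscale α d k := by
  refine finsum_congr fun l => ?_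
  by_cases hl : |k - 2 * l| ≤ N
  · rw [h l hl]
  · rw [hN _ (not_le.1 hl), zero_smul, zero_smul]

/-- The dependence radius after `j` steps is `N (1 + 2 + ⋯ + 2 ^ (j - 1))`, which is at most `N * 2
^ j`. -/
theorem upscale_iterate_congr {N : ℕ} (hN : ∀ i : ℤ, (N : ℤ) < |i| → α i = 0) (j : ℕ) :
    ∀ {c d : ℤ → E} {k : ℤ}, (∀ l, |k - 2 ^ j * l| ≤ N * 2 ^ j → c l = d l) →
      (upscale α)^[j] c k = (upscale α)^[j] d k := by
  induction j with
  | zero => intro c d k h; exact h k (by simp)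
  | succ j ih =>
    intro c d k h
    rw [Function.iterate_succ_apply, Function.iterate_succ_apply]
    refine ih fun m hm => upscale_congr hN fun l hl => h l ?_
    have e : k - 2 ^ (j + 1) * l = (k - 2 ^ j * m) + 2 ^ j * (m - 2 * l) := by ring
    rw [e]
    refine (abs_add_le _ _).trans ?_
    rw [abs_mul, abs_of_pos (by positivity : (0 : ℤ) < 2 ^ j)]
    have : (2 : ℤ) ^ j * |m - 2 * l| ≤ 2 ^ j * N := by gcongr
    rw [pow_succ]; linarith

variable (α)

theorem upscale_iterate_add (j : ℕ) (c d : ℤ → E) :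
    (upscale α)^[j] (c + d) = (upscale α)^[j] c + (upscale α)^[j] d := by
  induction j generalizing c d with
  | zero => rfl
  | succ j ih => simp only [Function.iterate_succ_apply, upscale_add, ih]

theorem upscale_iterate_sum (j : ℕ) (F : Finset ℤ) (c : ℤ → ℤ → E) :
    (upscale α)^[j] (∑ l ∈ F, c l) = ∑ l ∈ F, (upscale α)^[j] (c l) :=
  map_sum (AddMonoidHom.mk' (upscale α)^[j] (upscale_iterate_add α j)) c F

theorem upscale_iterate_smul_const (j : ℕ) (a : ℤ → ℝ) (x : E) :
    (upscale α)^[j] (fun k => a k • x) = fun k => (upscale α)^[j] a k • x := by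
  induction j generalizing a with
  | zero => rfl
  | succ j ih => simp only [Function.iterate_succ_apply, upscale_smul_const, ih]

theorem upscale_iterate_translate (j : ℕ) (c : ℤ → E) (n : ℤ) :
    (upscale α)^[j] (fun k => c (k - n)) = fun k => (upscale α)^[j] c (k - 2 ^ j * n) := by
  induction j generalizing c n with
  | zero => simp
  | succ j ih =>
    rw [Function.iterate_succ_apply, upscale_translate, ih]
    funext k
    rw [Function.iterate_succ_apply, pow_succ, mul_assoc]

variable {α}

/-- The iterates of `S_α` are linear rules whose filter is the impulse response. -/
theorem upscale_iterate_eq_sum {N : ℕ} (hN : ∀ i : ℤ, (N : ℤ) < |i| → α i = 0) (j : ℕ)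
    (c : ℤ → E) (k : ℤ) (F : Finset ℤ) (hF : ∀ l, |k - 2 ^ j * l| ≤ N * 2 ^ j → l ∈ F) :
    (upscale α)^[j] c k =
      ∑ l ∈ F, (upscale α)^[j] (Pi.single 0 1 : ℤ → ℝ) (k - 2 ^ j * l) • c l := by
  -- On the window that matters, `c` agrees with a finite superposition of translated impulses.
  have h1 : (upscale α)^[j] c k = (upscale α)^[j]
      (∑ l ∈ F, fun i : ℤ => (Pi.single 0 1 : ℤ → ℝ) (i - l) • c l) k := by
    refine upscale_iterate_congr hN j fun l hl => ?_
    rw [Finset.sum_apply, Finset.sum_eq_single_of_mem l (hF l hl)]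
    · simp
    · intro b _ hb
      rw [Pi.single_eq_of_ne (by omega), zero_smul]
  rw [h1, upscale_iterate_sum, Finset.sum_apply]
  refine Finset.sum_congr rfl fun l _ => ?_
  rw [upscale_iterate_smul_const α j (fun i => (Pi.single 0 1 : ℤ → ℝ) (i - l)),
    upscale_iterate_translate α j (Pi.single 0 1 : ℤ → ℝ)]

/-- The number of coarse entries that influence a given fine entry is bounded independently of `j`;
this makes the later constants uniform in the level. -/
theorem mem_window {N : ℕ} {j : ℕ} {k l : ℤ} (h : |k - 2 ^ j * l| ≤ N * 2 ^ j) :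
    l ∈ Finset.Icc (k / 2 ^ j - N) (k / 2 ^ j + N + 1) := by
  have hp : (0 : ℤ) < 2 ^ j := by positivity
  have h1 := Int.mul_ediv_add_emod k (2 ^ j)
  have h2 := Int.emod_nonneg k hp.ne'
  have h3 := Int.emod_lt_of_pos k hp
  rw [abs_le] at h
  rw [Finset.mem_Icc]
  constructor
  · by_contra! hc
    have : 2 ^ j * (l + 1) ≤ 2 ^ j * (k / 2 ^ j - N) := by gcongr; omega
    nlinarith
  · by_contra! hc
    have : 2 ^ j * (k / 2 ^ j + N + 2) ≤ 2 ^ j * l := by gcongr; omega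
    nlinarith

theorem impulse_eq_zero {N : ℕ} (hN : ∀ i : ℤ, (N : ℤ) < |i| → α i = 0) (j : ℕ) (k : ℤ)
    (hk : (N : ℤ) * 2 ^ j < |k|) : (upscale α)^[j] (Pi.single 0 1 : ℤ → ℝ) k = 0 := by
  have h0 : (upscale α)^[j] (0 : ℤ → ℝ) = 0 :=
    map_zero (AddMonoidHom.mk' (upscale α)^[j] (upscale_iterate_add α j))
  rw [upscale_iterate_congr hN j (d := 0), h0, Pi.zero_apply]
  intro l hl
  have : l ≠ 0 := by
    rintro rfl
    simp only [mul_zero, sub_zero] at hl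
    omega
  rw [Pi.single_eq_of_ne this, Pi.zero_apply]

theorem IsSubdivisionLimit.eventually_le {c : ℤ → ℝ} {φ : ℝ → ℝ} (hφ : IsSubdivisionLimit α c φ)
    {ε : ℝ} (hε : 0 < ε) :
    ∀ᶠ j : ℕ in atTop, ∀ k : ℤ, |(upscale α)^[j] c k - φ ((k : ℝ) / 2 ^ j)| ≤ ε := by
  filter_upwards [hφ.2.eventually_le_const (ENNReal.ofReal_pos.2 hε)] with j hj k
  exact (seqNorm_le_ofReal_iff hε.le).1 hj k

/-- Functions on the grids `2⁻ʲ ℤ`, supported in a bounded interval, that are eventually close to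
a continuous function, are uniformly bounded. -/
theorem exists_grid_bound {N : ℕ} {a : ℕ → ℤ → ℝ} {φ : ℝ → ℝ} (hφ : Continuous φ)
    (hz : ∀ (j : ℕ) (k : ℤ), (N : ℤ) * 2 ^ j < |k| → a j k = 0)
    (hJ : ∀ᶠ j : ℕ in atTop, ∀ k : ℤ, |a j k - φ ((k : ℝ) / 2 ^ j)| ≤ 1) :
    ∃ A : ℝ, 0 ≤ A ∧ ∀ j k, |a j k| ≤ A := by
  obtain ⟨J, hJ⟩ := eventually_atTop.1 hJ
  obtain ⟨B, hB⟩ := (isCompact_Icc (a := -(N : ℝ)) (b := N)).exists_bound_of_continuousOn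
    hφ.continuousOn
  have hB0 : 0 ≤ B := (norm_nonneg _).trans (hB 0 (by simp))
  -- On a single level only finitely many entries are nonzero. This covers the levels below `J`,
  -- where closeness to `φ` is not available.
  have hg : ∀ j, ∃ g : ℝ, 0 ≤ g ∧ ∀ k, |a j k| ≤ g := fun j => by
    refine ⟨∑ k ∈ Finset.Icc (-((N : ℤ) * 2 ^ j)) (N * 2 ^ j), |a j k|, by positivity, fun k => ?_⟩
    by_cases hk : (N : ℤ) * 2 ^ j < |k|
    · rw [hz j k hk, abs_zero]; positivity
    · exact Finset.single_le_sum (f := fun k => |a j k|) (fun _ _ => abs_nonneg _)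
        (Finset.mem_Icc.2 (abs_le.1 (not_lt.1 hk)))
  choose g hg0 hg using hg
  have hG0 : 0 ≤ ∑ j ∈ Finset.range J, g j := Finset.sum_nonneg fun j _ => hg0 j
  refine ⟨B + 1 + ∑ j ∈ Finset.range J, g j, by positivity, fun j k => ?_⟩
  rcases lt_or_ge j J with hj | hj
  · have h2 : g j ≤ ∑ j ∈ Finset.range J, g j :=
      Finset.single_le_sum (fun j _ => hg0 j) (Finset.mem_range.2 hj)
    have := hg j k
    linarith
  by_cases hk : (N : ℤ) * 2 ^ j < |k|
  · rw [hz j k hk, abs_zero]; positivity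
  · rw [not_lt, abs_le] at hk
    have h1 := hJ j hj k
    have h2 := hB ((k : ℝ) / 2 ^ j) (by
      have hk1 : -((N : ℝ) * 2 ^ j) ≤ k := by exact_mod_cast hk.1
      have hk2 : (k : ℝ) ≤ N * 2 ^ j := by exact_mod_cast hk.2
      rw [Set.mem_Icc, le_div_iff₀ (by positivity), div_le_iff₀ (by positivity)]
      exact ⟨by linarith, hk2⟩)
    rw [Real.norm_eq_abs] at h2
    have h3 := abs_add_le (a j k - φ (k / 2 ^ j)) (φ (k / 2 ^ j))
    rw [sub_add_cancel] at h3
    linarith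

/-- The impulse responses of a convergent rule are bounded uniformly in the level. -/
theorem exists_impulse_bound {N : ℕ} (hN : ∀ i : ℤ, (N : ℤ) < |i| → α i = 0) {φ : ℝ → ℝ}
    (hφ : IsSubdivisionLimit α (Pi.single 0 1) φ) :
    ∃ A : ℝ, 0 ≤ A ∧ ∀ j k, |(upscale α)^[j] (Pi.single 0 1 : ℤ → ℝ) k| ≤ A := by
  exact exists_grid_bound hφ.1 (impulse_eq_zero hN) (hφ.eventually_le one_pos)

/-- The differences of the impulse responses of a convergent rule tend to zero uniformly. -/
theorem eventually_impulse_diff_le {N : ℕ} (hN : ∀ i : ℤ, (N : ℤ) < |i| → α i = 0) {φ : ℝ → ℝ}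
    (hφ : IsSubdivisionLimit α (Pi.single 0 1) φ) {ε : ℝ} (hε : 0 < ε) :
    ∀ᶠ j : ℕ in atTop, ∀ k, |(upscale α)^[j] (Pi.single 0 1 : ℤ → ℝ) (k + 1) -
      (upscale α)^[j] (Pi.single 0 1 : ℤ → ℝ) k| ≤ ε := by
  -- The interval is padded by `1` so that two neighbouring grid points either both lie in it or
  -- both lie outside the support of the impulse response.
  have huc := (isCompact_Icc (a := -((N : ℝ) + 1)) (b := N + 1)).uniformContinuousOn_of_continuous
    hφ.1.continuousOn
  obtain ⟨δ, hδ, hφδ⟩ := Metric.uniformContinuousOn_iff.1 huc (ε / 3) (by positivity)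
  have hsmall : ∀ᶠ j : ℕ in atTop, ((1 / 2 : ℝ)) ^ j < δ :=
    (tendsto_pow_atTop_nhds_zero_of_lt_one (by norm_num) (by norm_num)).eventually_lt_const hδ
  filter_upwards [hφ.eventually_le (ε := ε / 3) (by positivity), hsmall] with j hj hjδ k
  have hp : (1 : ℝ) ≤ 2 ^ j := one_le_pow₀ (by norm_num)
  by_cases hk : |k| ≤ (N : ℤ) * 2 ^ j + 1 ∧ |k + 1| ≤ (N : ℤ) * 2 ^ j + 1
  · obtain ⟨h1, h2⟩ := hk
    rw [abs_le] at h1 h2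
    have mem : ∀ i : ℤ, -((N : ℤ) * 2 ^ j + 1) ≤ i ∧ i ≤ (N : ℤ) * 2 ^ j + 1 →
        (i : ℝ) / 2 ^ j ∈ Set.Icc (-((N : ℝ) + 1)) (N + 1) := by
      intro i hi
      have h1 : -((N : ℝ) * 2 ^ j + 1) ≤ i := by exact_mod_cast hi.1
      have h2 : (i : ℝ) ≤ N * 2 ^ j + 1 := by exact_mod_cast hi.2
      rw [Set.mem_Icc, le_div_iff₀ (by positivity), div_le_iff₀ (by positivity)]
      constructor <;> nlinarith
    have h3 := hφδ _ (mem _ h2) _ (mem _ h1) (by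
      rw [Real.dist_eq, ← sub_div]
      push_cast
      rw [add_sub_cancel_left, abs_of_pos (by positivity)]
      simpa using hjδ)
    rw [Real.dist_eq] at h3
    have h4 := hj (k + 1)
    have h5 := hj k
    rw [abs_le] at h4 h5 ⊢
    rw [abs_lt] at h3
    constructor <;> linarith [h3.1, h3.2, h4.1, h4.2, h5.1, h5.2]
  · have : (N : ℤ) * 2 ^ j < |k| ∧ (N : ℤ) * 2 ^ j < |k + 1| := by
      generalize (N : ℤ) * 2 ^ j = M at hk
      rw [not_and_or, not_le, not_le] at hk
      constructor
      · have := abs_sub_abs_le_abs_sub (k + 1) k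
        simp only [add_sub_cancel_left, abs_one] at this
        omega
      · have := abs_sub_abs_le_abs_sub k (k + 1)
        rw [show k - (k + 1) = -1 by ring, abs_neg, abs_one] at this
        omega
    rw [impulse_eq_zero hN j _ this.1, impulse_eq_zero hN j _ this.2, sub_zero, abs_zero]
    exact hε.le

theorem norm_upscale_iterate_le {N : ℕ} (hN : ∀ i : ℤ, (N : ℤ) < |i| → α i = 0) {A : ℝ}
    (hA : ∀ j k, |(upscale α)^[j] (Pi.single 0 1 : ℤ → ℝ) k| ≤ A) {c : ℤ → E} {a : ℝ}
    (ha : ∀ i, ‖c i‖ ≤ a) (j : ℕ) (k : ℤ) :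
    ‖(upscale α)^[j] c k‖ ≤ (2 * N + 2 : ℝ) * A * a := by
  have hA0 : 0 ≤ A := (abs_nonneg _).trans (hA 0 0)
  rw [upscale_iterate_eq_sum hN j _ k _ fun l hl => mem_window hl]
  refine (norm_sum_le_of_le _ (f := _) (n := fun _ => A * a) fun l _ => ?_).trans ?_
  · rw [norm_smul]
    exact mul_le_mul (hA _ _) (ha _) (norm_nonneg _) hA0
  · rw [Finset.sum_const, Int.card_Icc, nsmul_eq_mul]
    have : (k / 2 ^ j + N + 1 + 1 - (k / 2 ^ j - N)).toNat = 2 * N + 2 := by omega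
    rw [this]; push_cast; linarith

/-- Reproduction of constants makes the differenced coefficients sum to zero, so a reference value
`c q` may be subtracted from all entries of the window. What remains are `2 * N + 3` products of a
small coefficient and a difference `c l - c q`, itself at most `2 * N + 3` increments. -/
theorem norm_fwdDiff_upscale_iterate_le {N : ℕ} (hN : ∀ i : ℤ, (N : ℤ) < |i| → α i = 0)
    (hone : upscale α (fun _ => (1 : ℝ)) = fun _ => 1) (j : ℕ) {ε : ℝ}
    (hε : ∀ k, |(upscale α)^[j] (Pi.single 0 1 : ℤ → ℝ) (k + 1) -
      (upscale α)^[j] (Pi.single 0 1 : ℤ → ℝ) k| ≤ ε) {c : ℤ → E} {η : ℝ}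
    (hη : ∀ i, ‖fwdDiffSeq c i‖ ≤ η) (k : ℤ) :
    ‖fwdDiffSeq ((upscale α)^[j] c) k‖ ≤ (2 * N + 3 : ℝ) * (ε * ((2 * N + 3) * η)) := by
  have hε0 : 0 ≤ ε := (abs_nonneg _).trans (hε 0)
  set a : ℤ → ℝ := (upscale α)^[j] (Pi.single 0 1 : ℤ → ℝ) with ha
  have hp : (0 : ℤ) < 2 ^ j := by positivity
  set q : ℤ := k / 2 ^ j with hq
  have hq' : (k + 1) / 2 ^ j = q ∨ (k + 1) / 2 ^ j = q + 1 := by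
    have h1 : q ≤ (k + 1) / 2 ^ j := Int.ediv_le_ediv hp (by omega)
    have h2 : (k + 1) / 2 ^ j ≤ q + 1 := by
      have e : q + 1 = (k + 2 ^ j * 1) / 2 ^ j := by
        rw [Int.add_mul_ediv_left _ _ hp.ne']
      rw [e]
      exact Int.ediv_le_ediv hp (by omega)
    omega
  set F : Finset ℤ := Finset.Icc (q - N) (q + N + 2) with hF
  have hF0 : ∀ l, |k - 2 ^ j * l| ≤ N * 2 ^ j → l ∈ F := by
    intro l hl
    have := Finset.mem_Icc.1 (mem_window hl)
    rw [hF, Finset.mem_Icc]; omega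
  have hF1 : ∀ l, |k + 1 - 2 ^ j * l| ≤ N * 2 ^ j → l ∈ F := by
    intro l hl
    have := Finset.mem_Icc.1 (mem_window hl)
    rw [hF, Finset.mem_Icc]; omega
  have hsum : ∑ l ∈ F, (a (k + 1 - 2 ^ j * l) - a (k - 2 ^ j * l)) = 0 := by
    have h1 : ∀ j, (upscale α)^[j] (fun _ => (1 : ℝ)) = fun _ => 1 := fun j =>
      Function.iterate_fixed hone j
    have h2 := upscale_iterate_eq_sum hN j (fun _ => (1 : ℝ)) k F hF0
    have h3 := upscale_iterate_eq_sum hN j (fun _ => (1 : ℝ)) (k + 1) F hF1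
    rw [h1] at h2 h3
    simp only [smul_eq_mul, mul_one] at h2 h3
    rw [Finset.sum_sub_distrib, ← h2, ← h3, sub_self]
  have e : fwdDiffSeq ((upscale α)^[j] c) k =
      ∑ l ∈ F, (a (k + 1 - 2 ^ j * l) - a (k - 2 ^ j * l)) • (c l - c q) := by
    simp_rw [smul_sub]
    rw [Finset.sum_sub_distrib, ← Finset.sum_smul, hsum, zero_smul, sub_zero]
    simp only [fwdDiffSeq, sub_smul]
    rw [Finset.sum_sub_distrib, upscale_iterate_eq_sum hN j c k F hF0,
      upscale_iterate_eq_sum hN j c (k + 1) F hF1]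
  rw [e]
  refine (norm_sum_le_of_le _ (f := _) (n := fun _ => ε * ((2 * N + 3) * η)) fun l hl => ?_).trans ?_
  · rw [norm_smul]
    refine mul_le_mul ?_ ?_ (norm_nonneg _) hε0
    · have := hε (k - 2 ^ j * l)
      rwa [show k - 2 ^ j * l + 1 = k + 1 - 2 ^ j * l by ring] at this
    · have := norm_sub_le_of_fwdDiffSeq_le hη (2 * N + 3) q l (by
        rw [hF, Finset.mem_Icc] at hl
        rw [abs_le]; push_cast; omega)
      exact_mod_cast this
  · rw [Finset.sum_const, Int.card_Icc, nsmul_eq_mul]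
    have : (q + N + 2 + 1 - (q - N)).toNat = 2 * N + 3 := by omega
    rw [this]; push_cast; linarith

end Upscale

/-! ### Norms adapted to a power bounded operator. -/

section AdaptedNorms

variable {E : Type*} [NormedAddCommGroup E]

/-- Bounded sequences. -/
def IsBdd (x : ℤ → E) : Prop := ∃ a : ℝ, ∀ i, ‖x i‖ ≤ a

theorem IsBdd.add {x y : ℤ → E} (hx : IsBdd x) (hy : IsBdd y) : IsBdd (x + y) := by
  obtain ⟨a, ha⟩ := hx
  obtain ⟨b, hb⟩ := hy
  exact ⟨a + b, fun i => (norm_add_le _ _).trans (add_le_add (ha i) (hb i))⟩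

/-- A norm `p`, equivalent to the sup norm, which the operator `T` does not increase, together
with a seminorm `q` which `T` contracts. -/
structure AdaptedNorms (T : (ℤ → E) → ℤ → E) (p q : (ℤ → E) → ℝ) (C γ : ℝ) : Prop where
  const_nonneg : 0 ≤ C
  rate_nonneg : 0 ≤ γ
  rate_lt_one : γ < 1
  bdd_map : ∀ {x}, IsBdd x → IsBdd (T x)
  p_add : ∀ {x y}, IsBdd x → IsBdd y → p (x + y) ≤ p x + p y
  q_add : ∀ {x y}, IsBdd x → IsBdd y → q (x + y) ≤ q x + q y
  norm_le : ∀ {x}, IsBdd x → ∀ i, ‖x i‖ ≤ p x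
  p_le : ∀ {x a}, (∀ i, ‖x i‖ ≤ a) → p x ≤ C * a
  q_le : ∀ {x a}, (∀ i, ‖x i‖ ≤ a) → q x ≤ C * a
  q_nonneg : ∀ x, 0 ≤ q x
  p_map : ∀ {x}, IsBdd x → p (T x) ≤ p x
  q_map : ∀ {x}, IsBdd x → q (T x) ≤ γ * q x

/-- Splitting only repeats entries, so the sup norm works; the linearization in this case is exact
and needs no control of differences, whence `q = 0`. -/
theorem adaptedNorms_splitting :
    AdaptedNorms (fun (c : ℤ → E) k => c (k / 2)) (fun x => ⨆ i, ‖x i‖) (fun _ => 0) 1 0 := by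
  have bdd : ∀ {x : ℤ → E}, IsBdd x → BddAbove (Set.range fun i => ‖x i‖) := by
    rintro x ⟨a, ha⟩
    exact ⟨a, by rintro _ ⟨i, rfl⟩; exact ha i⟩
  refine ⟨zero_le_one, le_rfl, zero_lt_one, ?_, ?_, ?_, ?_, ?_, ?_, ?_, ?_, ?_⟩
  · rintro x ⟨a, ha⟩; exact ⟨a, fun i => ha _⟩
  · intro x y hx hy
    exact ciSup_le fun i => (norm_add_le _ _).trans
      (add_le_add (le_ciSup (bdd hx) i) (le_ciSup (bdd hy) i))
  · simp
  · intro x hx i; exact le_ciSup (bdd hx) i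
  · intro x a ha; rw [one_mul]; exact ciSup_le ha
  · intro x a ha; rw [one_mul]; exact (norm_nonneg _).trans (ha 0)
  · simp
  · intro x hx; exact ciSup_le fun i => le_ciSup (bdd hx) (i / 2)
  · simp

theorem fwdDiffSeq_add (x y : ℤ → E) : fwdDiffSeq (x + y) = fwdDiffSeq x + fwdDiffSeq y := by
  funext k; simp only [fwdDiffSeq, Pi.add_apply]; abel

/-- Adapted norms of a power bounded additive operator some power of which halves differences. -/
theorem exists_adaptedNorms_of_halving {T : (ℤ → E) → ℤ → E}
    (hadd : ∀ (j : ℕ) (x y : ℤ → E), T^[j] (x + y) = T^[j] x + T^[j] y) {B : ℝ} (hB1 : 0 ≤ B)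
    (hB : ∀ {x : ℤ → E} {a : ℝ}, (∀ i, ‖x i‖ ≤ a) → ∀ j i, ‖T^[j] x i‖ ≤ B * a)
    {n : ℕ} (hn : 0 < n) (hhalf : ∀ {x : ℤ → E} {η : ℝ}, (∀ i, ‖fwdDiffSeq x i‖ ≤ η) →
      ∀ i, ‖fwdDiffSeq (T^[n] x) i‖ ≤ 1 / 2 * η) :
    ∃ p q C γ, AdaptedNorms T p q C γ ∧ ∀ x, IsBdd x → ∀ i, ‖fwdDiffSeq x i‖ ≤ q x := by
  have hnR : (1 : ℝ) ≤ n := by exact_mod_cast hn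
  -- Chosen so that Bernoulli's inequality gives `1 / 2 ≤ γ ^ n`.
  set γ : ℝ := 1 + -(1 / (2 * n)) with hγ
  have hγ1 : γ < 1 := by
    have : 0 < 1 / (2 * (n : ℝ)) := by positivity
    linarith
  have hγ2 : 1 / 2 ≤ γ := by
    have : 1 / (2 * (n : ℝ)) ≤ 1 / 2 := by
      rw [div_le_div_iff₀ (by positivity) (by norm_num)]; linarith
    linarith
  have hγ0 : 0 < γ := by linarith
  have hγn : 1 / 2 ≤ γ ^ n := by
    have h := one_add_mul_le_pow (a := -(1 / (2 * (n : ℝ)))) (by linarith) n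
    rw [← hγ] at h
    refine le_trans (le_of_eq ?_) h
    field_simp
    norm_num
  have hγi : 1 ≤ γ⁻¹ := (one_le_inv₀ hγ0).2 hγ1.le
  have bddT : ∀ {x : ℤ → E}, IsBdd x → ∀ j, IsBdd (T^[j] x) := by
    rintro x ⟨a, ha⟩ j; exact ⟨B * a, hB ha j⟩
  have bp : ∀ {x : ℤ → E}, IsBdd x → BddAbove (Set.range fun z : ℕ × ℤ => ‖T^[z.1] x z.2‖) := by
    rintro x ⟨a, ha⟩
    exact ⟨B * a, by rintro _ ⟨z, rfl⟩; exact hB ha _ _⟩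
  have dle : ∀ {x : ℤ → E} {a : ℝ}, (∀ i, ‖x i‖ ≤ a) → ∀ z : Fin n × ℤ,
      γ⁻¹ ^ (z.1 : ℕ) * ‖fwdDiffSeq (T^[z.1] x) z.2‖ ≤ γ⁻¹ ^ n * (2 * B) * a := by
    intro x a ha z
    have ha0 : 0 ≤ a := (norm_nonneg _).trans (ha 0)
    have h1 : γ⁻¹ ^ (z.1 : ℕ) ≤ γ⁻¹ ^ n := pow_le_pow_right₀ hγi z.1.2.le
    have h2 : ‖fwdDiffSeq (T^[z.1] x) z.2‖ ≤ 2 * B * a := by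
      refine (norm_sub_le _ _).trans ?_
      have := hB ha z.1 (z.2 + 1); have := hB ha z.1 z.2
      linarith
    rw [mul_assoc]
    exact mul_le_mul h1 h2 (norm_nonneg _) (by positivity)
  have bq : ∀ {x : ℤ → E}, IsBdd x → BddAbove (Set.range fun z : Fin n × ℤ =>
      γ⁻¹ ^ (z.1 : ℕ) * ‖fwdDiffSeq (T^[z.1] x) z.2‖) := by
    rintro x ⟨a, ha⟩
    exact ⟨_, by rintro _ ⟨z, rfl⟩; exact dle ha z⟩
  have : Nonempty (Fin n × ℤ) := ⟨(⟨0, hn⟩, 0)⟩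
  have dq : ∀ x : ℤ → E, IsBdd x → ∀ i, ‖fwdDiffSeq x i‖ ≤
      ⨆ z : Fin n × ℤ, γ⁻¹ ^ (z.1 : ℕ) * ‖fwdDiffSeq (T^[z.1] x) z.2‖ := by
    intro x hx i
    have := le_ciSup (bq hx) (⟨0, hn⟩, i)
    simpa using this
  -- `p` is the supremum over the whole orbit, `q` a weighted maximum over the differences of the
  -- first `n` orbit members. Real suprema of unbounded families are `0`, which is why most fields
  -- of `AdaptedNorms` assume bounded input.
  refine ⟨fun x => ⨆ z : ℕ × ℤ, ‖T^[z.1] x z.2‖,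
    fun x => ⨆ z : Fin n × ℤ, γ⁻¹ ^ (z.1 : ℕ) * ‖fwdDiffSeq (T^[z.1] x) z.2‖,
    B + γ⁻¹ ^ n * (2 * B), γ, ⟨by positivity, hγ0.le, hγ1, fun hx => bddT hx 1,
    ?_, ?_, ?_, ?_, ?_, ?_, ?_, ?_⟩, dq⟩
  · intro x y hx hy
    refine ciSup_le fun z => ?_
    rw [hadd]
    exact (norm_add_le _ _).trans (add_le_add (le_ciSup (bp hx) z) (le_ciSup (bp hy) z))
  · intro x y hx hy
    refine ciSup_le fun z => ?_
    rw [hadd, fwdDiffSeq_add]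
    refine le_trans ?_ (add_le_add (le_ciSup (bq hx) z) (le_ciSup (bq hy) z))
    rw [← mul_add]
    exact mul_le_mul_of_nonneg_left (norm_add_le _ _) (by positivity)
  · intro x hx i
    exact le_ciSup (bp hx) (0, i)
  · intro x a ha
    have ha0 : 0 ≤ a := (norm_nonneg _).trans (ha 0)
    refine ciSup_le fun z => (hB ha _ _).trans ?_
    rw [add_mul]
    have : 0 ≤ γ⁻¹ ^ n * (2 * B) * a := by positivity
    linarith
  · intro x a ha
    have ha0 : 0 ≤ a := (norm_nonneg _).trans (ha 0)
    refine ciSup_le fun z => (dle ha z).trans ?_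
    rw [add_mul]
    have : 0 ≤ B * a := by positivity
    linarith
  · intro x
    exact Real.iSup_nonneg fun z => by positivity
  · intro x hx
    exact ciSup_le fun z => le_ciSup (bp hx) (z.1 + 1, z.2)
  · intro x hx
    refine ciSup_le fun z => ?_
    obtain ⟨⟨j, hj⟩, i⟩ := z
    simp only [← Function.iterate_succ_apply]
    rcases Nat.lt_or_ge (j + 1) n with h | h
    · have h1 := le_ciSup (bq hx) (⟨j + 1, h⟩, i)
      simp only [Function.iterate_succ_apply] at h1 ⊢
      refine le_trans (le_of_eq ?_) (mul_le_mul_of_nonneg_left h1 hγ0.le)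
      rw [pow_succ]
      field_simp
    -- The last orbit member is mapped to `T^[n] x`, no longer among those measured by `q`; halving
    -- together with `1 / 2 ≤ γ ^ n` closes the cycle.
    · obtain rfl : n = j + 1 := by omega
      refine (mul_le_mul_of_nonneg_left (hhalf (dq x hx) i) (by positivity)).trans ?_
      rw [← mul_assoc]
      refine mul_le_mul_of_nonneg_right ?_ (Real.iSup_nonneg fun z => by positivity)
      rw [inv_pow, inv_mul_le_iff₀ (by positivity), ← pow_succ]
      exact hγn

end AdaptedNorms

/-! ### Adapted norms for convergent subdivision rules. -/

section Convergent

variable {E : Type*} [NormedAddCommGroup E] [NormedSpace ℝ E] {α : ℤ →₀ ℝ}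

theorem exists_adaptedNorms_upscale (hα : IsConvergentSubdivision α)
    (hone : upscale α (fun _ => (1 : ℝ)) = fun _ => 1) :
    ∃ p q C γ, AdaptedNorms (upscale (E := E) α) p q C γ ∧
      ∀ x, IsBdd x → ∀ i, ‖fwdDiffSeq x i‖ ≤ q x := by
  obtain ⟨N, hN⟩ := exists_abs_bound α
  obtain ⟨φ, hφ⟩ := hα.1 (Pi.single 0 1) (by
    refine lt_of_le_of_lt ((seqNorm_le_ofReal_iff zero_le_one).2 fun i => ?_) ENNReal.ofReal_lt_top
    by_cases hi : i = 0
    · subst hi; simp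
    · rw [Pi.single_eq_of_ne hi]; simp)
  obtain ⟨A, hA0, hA⟩ := exists_impulse_bound hN hφ
  -- This threshold turns the factor `(2 * N + 3) ^ 2 * ε` of `norm_fwdDiff_upscale_iterate_le` into
  -- `1 / 2`.
  have hε : 0 < 1 / (2 * (2 * N + 3 : ℝ) ^ 2) := by positivity
  obtain ⟨n, hn, hn1⟩ := ((eventually_impulse_diff_le hN hφ hε).and (eventually_gt_atTop 0)).exists
  refine exists_adaptedNorms_of_halving (upscale_iterate_add α) (B := (2 * N + 2 : ℝ) * A)
    (by positivity) (fun ha j i => norm_upscale_iterate_le hN hA ha j i) hn1 fun hη i => ?_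
  refine (norm_fwdDiff_upscale_iterate_le hN hone n hn hη i).trans (le_of_eq ?_)
  field_simp

end Convergent

/-! ### Scalar recursions. -/

/-- A Gronwall estimate for a pair of coupled quantities, `a` of nearly constant and `b` of
contracting size, valid as long as `a` stays below the threshold `r`. -/
theorem coupled_gronwall {C γ H r : ℝ} (hC : 0 ≤ C) (hγ : γ < 1) (hH : 0 ≤ H)
    (hr : 0 < r) (hr1 : r ≤ 1) (hCr : 2 * (C * r) ≤ 1 - γ) :
    ∃ E M : ℝ, 0 < E ∧ 0 ≤ M ∧ ∀ (n : ℕ) (a b s m : ℕ → ℝ) (Good : ℕ → Prop),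
      (∀ k, 0 ≤ a k) → (∀ k, 0 ≤ b k) → (∀ k, 0 ≤ s k) → (∀ k, 0 ≤ m k) →
      (∀ k, ∑ i ∈ Finset.range k, m i ≤ H) → (∀ k < n, s k ≤ E * m k) →
      Good 0 → a 0 ≤ E → b 0 ≤ C →
      (∀ k < n, Good k → a k ≤ r → Good (k + 1) ∧
        a (k + 1) ≤ (1 + C * (m k + b k)) * a k + C * s k ∧
        b (k + 1) ≤ γ * b k + C * (m k + b k) * a k + C * s k) →
      ∀ k ≤ n, Good k ∧ a k ≤ M * (a 0 + ∑ i ∈ Finset.range k, s i) := by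
  -- While `C * a k ≤ κ`, half of the gap `1 - γ` absorbs the term `C * b k * a k`, leaving `b (k +
  -- 1) ≤ (1 - κ) * b k + 2 * C * m k`. Summation bounds `∑ b`, and `X` is the resulting bound for
  -- the exponent.
  set κ : ℝ := (1 - γ) / 2 with hκ
  have hκ0 : 0 < κ := by rw [hκ]; linarith
  set X : ℝ := C * H + C * ((C + 2 * C * H) / κ) with hX
  have hM : 0 < Real.exp X * (1 + C) := by positivity
  set M : ℝ := Real.exp X * (1 + C) with hMdef
  -- The second entry of the minimum yields `M * (a 0 + ∑ s) ≤ M * E * (1 + H) ≤ r`, so the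
  -- threshold reproduces itself; `E ≤ 1` gives `s k ≤ m k`.
  refine ⟨min 1 (r / (M * (1 + H))), M, lt_min one_pos (by positivity), hM.le, ?_⟩
  set E : ℝ := min 1 (r / (M * (1 + H))) with hE
  intro n a b s m Good ha hb hs hm hmH hsm hG ha0 hb0 step
  have hE1 : E ≤ 1 := min_le_left _ _
  have hE0 : 0 < E := lt_min one_pos (by positivity)
  have hEr : M * (E * (1 + H)) ≤ r := by
    have h := min_le_right 1 (r / (M * (1 + H)))
    rw [← hE, le_div_iff₀ (by positivity)] at h
    linarith
  have bound : ∀ k ≤ n,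
      a k ≤ Real.exp (∑ i ∈ Finset.range k, C * (m i + b i)) *
        (a 0 + C * ∑ i ∈ Finset.range k, s i) →
      b k + κ * ∑ i ∈ Finset.range k, b i ≤ C + 2 * C * ∑ i ∈ Finset.range k, m i →
      a k ≤ M * (a 0 + ∑ i ∈ Finset.range k, s i) ∧ a k ≤ r := by
    intro k hk h1 h2
    have hS0 : 0 ≤ ∑ i ∈ Finset.range k, s i := Finset.sum_nonneg fun i _ => hs i
    have hsumb : ∑ i ∈ Finset.range k, b i ≤ (C + 2 * C * H) / κ := by
      rw [le_div_iff₀ hκ0]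
      have : 2 * C * ∑ i ∈ Finset.range k, m i ≤ 2 * C * H :=
        mul_le_mul_of_nonneg_left (hmH k) (by positivity)
      have := hb k
      linarith
    have hXk : ∑ i ∈ Finset.range k, C * (m i + b i) ≤ X := by
      rw [← Finset.mul_sum, Finset.sum_add_distrib, mul_add]
      exact add_le_add (mul_le_mul_of_nonneg_left (hmH k) hC)
        (mul_le_mul_of_nonneg_left hsumb hC)
    have h3 : a k ≤ M * (a 0 + ∑ i ∈ Finset.range k, s i) := by
      refine h1.trans ?_
      rw [hMdef, mul_assoc]
      refine mul_le_mul (Real.exp_le_exp.2 hXk) ?_ ?_ (Real.exp_nonneg _)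
      · have := ha 0
        nlinarith
      · have := ha 0
        positivity
    refine ⟨h3, h3.trans (le_trans ?_ hEr)⟩
    refine mul_le_mul_of_nonneg_left ?_ hM.le
    have : ∑ i ∈ Finset.range k, s i ≤ E * H := by
      refine (Finset.sum_le_sum fun i hi => hsm i ?_).trans ?_
      · exact (Finset.mem_range.1 hi).trans_le hk
      · rw [← Finset.mul_sum]
        exact mul_le_mul_of_nonneg_left (hmH k) hE0.le
    linarith
  have main : ∀ k ≤ n, Good k ∧
      a k ≤ Real.exp (∑ i ∈ Finset.range k, C * (m i + b i)) *
        (a 0 + C * ∑ i ∈ Finset.range k, s i) ∧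
      b k + κ * ∑ i ∈ Finset.range k, b i ≤ C + 2 * C * ∑ i ∈ Finset.range k, m i := by
    intro k
    induction k with
    | zero => intro _; simpa using ⟨hG, hb0⟩
    | succ k ih =>
      intro hk
      obtain ⟨g, h1, h2⟩ := ih (by omega)
      have har := (bound k (by omega) h1 h2).2
      obtain ⟨g', ha', hb'⟩ := step k (by omega) g har
      refine ⟨g', ?_, ?_⟩
      · rw [Finset.sum_range_succ, Finset.sum_range_succ, Real.exp_add]
        set P := Real.exp (∑ i ∈ Finset.range k, C * (m i + b i)) with hP
        set Y := a 0 + C * ∑ i ∈ Finset.range k, s i with hY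
        set x := C * (m k + b k) with hx
        have hx0 : 0 ≤ x := mul_nonneg hC (add_nonneg (hm k) (hb k))
        have hP1 : 1 ≤ P := Real.one_le_exp (Finset.sum_nonneg fun i _ =>
          mul_nonneg hC (add_nonneg (hm i) (hb i)))
        have he1 : 1 ≤ Real.exp x := Real.one_le_exp hx0
        have he2 : 1 + x ≤ Real.exp x := by linarith [Real.add_one_le_exp x]
        have hs0 : 0 ≤ C * s k := mul_nonneg hC (hs k)
        have i1 : (1 + x) * a k ≤ Real.exp x * (P * Y) :=
          mul_le_mul he2 h1 (ha k) (by positivity)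
        have i2 : 1 ≤ P * Real.exp x := one_le_mul_of_one_le_of_one_le hP1 he1
        have i3 : C * s k ≤ P * Real.exp x * (C * s k) := le_mul_of_one_le_left hs0 i2
        calc a (k + 1) ≤ (1 + x) * a k + C * s k := ha'
          _ ≤ Real.exp x * (P * Y) + P * Real.exp x * (C * s k) := add_le_add i1 i3
          _ = _ := by rw [hY]; ring
      · rw [Finset.sum_range_succ, Finset.sum_range_succ]
        have j1 : C * (m k + b k) * a k ≤ C * m k + κ * b k := by
          have e1 : C * m k * a k ≤ C * m k * 1 :=
            mul_le_mul_of_nonneg_left (har.trans hr1) (mul_nonneg hC (hm k))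
          have e2 : b k * (C * a k) ≤ b k * κ := by
            refine mul_le_mul_of_nonneg_left ?_ (hb k)
            have := mul_le_mul_of_nonneg_left har hC
            rw [hκ]; linarith
          linarith
        have j2 : C * s k ≤ C * m k := by
          refine mul_le_mul_of_nonneg_left ((hsm k (by omega)).trans ?_) hC
          exact mul_le_of_le_one_left (hm k) hE1
        have e : γ = 1 - 2 * κ := by rw [hκ]; ring
        rw [e] at hb'
        linarith
  intro k hk
  obtain ⟨g, h1, h2⟩ := main k hk
  exact ⟨g, (bound k hk h1 h2).1⟩

/-- A recursion with locally Lipschitz steps is Lipschitz stable over finitely many steps. -/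
theorem finite_steps_stable {r L : ℝ} (hr : 0 < r) (hL : 0 ≤ L) (n : ℕ) :
    ∀ ε : ℝ, 0 < ε → ∃ E M : ℝ, 0 < E ∧ 0 ≤ M ∧ ∀ (j : ℕ) (a s : ℕ → ℝ) (Good : ℕ → Prop),
      (∀ k, 0 ≤ a k) → (∀ k, 0 ≤ s k) → (∀ k < j, s k ≤ E) → Good 0 → a 0 ≤ E →
      (∀ k < j, Good k → a k ≤ r → s k ≤ r → Good (k + 1) ∧ a (k + 1) ≤ L * (a k + s k)) →
      ∀ k ≤ n, k ≤ j →
        Good k ∧ a k ≤ M * (a 0 + ∑ i ∈ Finset.range k, s i) ∧ a k ≤ ε := by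
  induction n with
  | zero =>
    intro ε hε
    refine ⟨ε, 1, hε, zero_le_one, fun j a s Good ha hs hsE hG ha0 step k hk _ => ?_⟩
    obtain rfl : k = 0 := by omega
    simpa using ⟨hG, ha0⟩
  | succ n ih =>
    intro ε hε
    -- The first `n` steps must end below `r`, so that one more step is admissible, and below `ε /
    -- (2 * (L + 1))`, so that its result stays below `ε`.
    obtain ⟨E, M, hE, hM, h⟩ := ih (min r (min ε (ε / (2 * (L + 1)))))
      (lt_min hr (lt_min hε (by positivity)))
    refine ⟨min E (min r (ε / (2 * (L + 1)))), M + L * (M + 1),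
      lt_min hE (lt_min hr (by positivity)), by positivity, ?_⟩
    intro j a s Good ha hs hsE hG ha0 step k hk hkj
    have hn := h j a s Good ha hs (fun k hk => (hsE k hk).trans (min_le_left _ _)) hG
      (ha0.trans (min_le_left _ _)) step
    have hsum : ∀ k, 0 ≤ ∑ i ∈ Finset.range k, s i := fun k => Finset.sum_nonneg fun i _ => hs i
    rcases Nat.lt_or_ge k (n + 1) with hlt | hge
    · obtain ⟨g, h1, h2⟩ := hn k (by omega) hkj
      refine ⟨g, h1.trans (mul_le_mul_of_nonneg_right ?_ (add_nonneg (ha 0) (hsum k))), ?_⟩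
      · have : 0 ≤ L * (M + 1) := by positivity
        linarith
      · exact h2.trans ((min_le_right _ _).trans (min_le_left _ _))
    · obtain rfl : k = n + 1 := by omega
      obtain ⟨g, h1, h2⟩ := hn n le_rfl (by omega)
      have hs1 := hsE n (by omega)
      obtain ⟨g', h3⟩ := step n (by omega) g (h2.trans (min_le_left _ _))
        (hs1.trans ((min_le_right _ _).trans (min_le_left _ _)))
      refine ⟨g', h3.trans ?_, h3.trans ?_⟩
      · rw [Finset.sum_range_succ]
        have h4 := hsum n
        have h5 := hs n
        have h6 := ha 0
        set A := a 0 + ∑ i ∈ Finset.range n, s i with hA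
        have e : a 0 + (∑ i ∈ Finset.range n, s i + s n) = A + s n := by rw [hA]; ring
        have hA0 : 0 ≤ A := by positivity
        rw [e]
        calc L * (a n + s n) ≤ L * (M * A + s n) := by gcongr
          _ ≤ (M + L * (M + 1)) * (A + s n) := by
            have : 0 ≤ M * A + M * s n + L * A + L * M * s n := by positivity
            linarith
      · have h4 : a n ≤ ε / (2 * (L + 1)) := h2.trans ((min_le_right _ _).trans (min_le_right _ _))
        have h5 : s n ≤ ε / (2 * (L + 1)) := hs1.trans ((min_le_right _ _).trans (min_le_right _ _))
        calc L * (a n + s n) ≤ L * (ε / (2 * (L + 1)) + ε / (2 * (L + 1))) := by gcongr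
          _ = ε * (L / (L + 1)) := by field_simp; ring
          _ ≤ ε * 1 := by
            gcongr
            rw [div_le_one (by positivity)]; linarith
          _ = ε := mul_one ε

/-! ### Uniform estimates near compact sets. -/

section Compactness

variable {X Y : Type*} [NormedAddCommGroup X] [NormedSpace ℝ X] [FiniteDimensional ℝ X]
  [NormedAddCommGroup Y] [NormedSpace ℝ Y]

theorem exists_isCompact_closedBall_subset {K U : Set X} (hK : IsCompact K) (hU : IsOpen U)
    (hKU : K ⊆ U) : ∃ (r : ℝ) (K₁ : Set X), 0 < r ∧ IsCompact K₁ ∧ K₁ ⊆ U ∧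
      ∀ x ∈ K, Metric.closedBall x r ⊆ K₁ := by
  have : ProperSpace X := FiniteDimensional.proper ℝ X
  obtain ⟨r, hr, h⟩ := hK.exists_cthickening_subset_open hU hKU
  exact ⟨r, _, hr, hK.cthickening, h, fun x hx => Metric.closedBall_subset_cthickening hx r⟩

/-- A `C¹` function is Lipschitz on balls around a compact set, with uniform radius and
constant. -/
theorem exists_lipschitz_near_compact {f : X → Y} {K U : Set X} (hK : IsCompact K)
    (hU : IsOpen U) (hKU : K ⊆ U) (hf : ContDiffOn ℝ 1 f U) :
    ∃ r C : ℝ, 0 < r ∧ 0 ≤ C ∧ ∀ x ∈ K, ∀ y z, ‖y - x‖ ≤ r → ‖z - x‖ ≤ r →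
      y ∈ U ∧ ‖f y - f z‖ ≤ C * ‖y - z‖ := by
  obtain ⟨r, K₁, hr, hK₁, hK₁U, hball⟩ := exists_isCompact_closedBall_subset hK hU hKU
  obtain ⟨C, hC⟩ := hK₁.exists_bound_of_continuousOn
    ((hf.continuousOn_fderiv_of_isOpen hU le_rfl).mono hK₁U)
  refine ⟨r, max C 0, hr, le_max_right _ _, fun x hx y z hy hz => ?_⟩
  have hy' : y ∈ Metric.closedBall x r := by rwa [Metric.mem_closedBall, dist_eq_norm]
  have hz' : z ∈ Metric.closedBall x r := by rwa [Metric.mem_closedBall, dist_eq_norm]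
  refine ⟨hK₁U (hball x hx hy'), ?_⟩
  -- The compact set need not be convex, but the balls are, so the mean value inequality is applied
  -- ball by ball.
  refine (convex_closedBall x r).norm_image_sub_le_of_norm_fderiv_le (𝕜 := ℝ) (fun w hw => ?_)
    (fun w hw => (hC w (hball x hx hw)).trans (le_max_left _ _)) hz' hy'
  exact (hf.contDiffAt (hU.mem_nhds (hK₁U (hball x hx hw)))).differentiableAt one_ne_zero

end Compactness

/-! ### Adding small vectors to points. -/

section PointVector

variable {E F : Type*} [NormedAddCommGroup E] [NormedSpace ℝ E]
  [NormedAddCommGroup F] [NormedSpace ℝ F]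
  {V : Set E} {W : Set F} {add : E → F → E} {sub : E → E → F}

theorem IsPointVectorPair.sub_self (h : IsPointVectorPair V W add sub) {p : E} (hp : p ∈ V) :
    sub p p = 0 := by
  obtain ⟨A, B, _, hAB⟩ := h.lipschitz
  have := (hAB p hp p hp).2
  simpa using this

theorem IsPointVectorPair.add_zero (h : IsPointVectorPair V W add sub) {p : E} (hp : p ∈ V) :
    add p 0 = p := by
  rw [← h.sub_self hp]; exact h.add_sub p hp p hp

/-- Adding a small vector is a translation up to an error which is small relative to it. -/
theorem IsPointVectorPair.exists_add_estimate [FiniteDimensional ℝ E] [FiniteDimensional ℝ F]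
    (h : IsPointVectorPair V W add sub) {K : Set E}
    (hK : IsCompact K) (hKV : K ⊆ V) :
    ∃ r C : ℝ, 0 < r ∧ 0 ≤ C ∧ ∀ p ∈ K, ∀ p' v v', ‖p' - p‖ ≤ r → ‖v‖ ≤ r → ‖v'‖ ≤ r →
      ‖add p v - add p' v' - (p - p')‖ ≤ C * (‖v‖ * ‖p - p'‖ + ‖v - v'‖) := by
  rcases K.eq_empty_or_nonempty with rfl | ⟨p₀, hp₀⟩
  · exact ⟨1, 0, one_pos, le_rfl, fun p hp => absurd hp (Set.notMem_empty p)⟩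
  have h0W : (0 : F) ∈ W := by
    rw [← h.sub_self (hKV hp₀)]; exact h.sub_mem _ (hKV hp₀) _ (hKV hp₀)
  obtain ⟨δ, K₁, hδ, hK₁, hK₁V, hball⟩ :=
    exists_isCompact_closedBall_subset hK h.isOpen_points hKV
  set f : E × F → E := fun x => add x.1 x.2 with hf
  have hO : IsOpen (V ×ˢ W) := h.isOpen_points.prod h.isOpen_vectors
  have hK0 : IsCompact (K₁ ×ˢ ({0} : Set F)) := hK₁.prod isCompact_singleton
  have hK0V : K₁ ×ˢ ({0} : Set F) ⊆ V ×ˢ W :=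
    Set.prod_mono hK₁V (Set.singleton_subset_iff.2 h0W)
  obtain ⟨r₁, C₁, hr₁, hC₁, H₁⟩ := exists_lipschitz_near_compact hK0 hO hK0V
    (h.smooth_add.of_le one_le_two)
  obtain ⟨r₂, C₂, hr₂, hC₂, H₂⟩ := exists_lipschitz_near_compact hK0 hO hK0V
    (h.smooth_add.fderiv_of_isOpen hO (m := 1) (by norm_num))
  refine ⟨min δ (min r₁ r₂), max C₁ C₂, lt_min hδ (lt_min hr₁ hr₂), le_max_of_le_left hC₁,
    fun p hp p' v v' hp' hv hv' => ?_⟩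
  have hmem : ∀ z ∈ Metric.closedBall p (min δ (min r₁ r₂)), z ∈ K₁ := fun z hz =>
    hball p hp (Metric.closedBall_subset_closedBall (min_le_left _ _) hz)
  have hdiff : ∀ z ∈ K₁, ∀ w : F, ‖(z, w) - (z, (0 : F))‖ = ‖w‖ := by
    intro z _ w; simp [Prod.norm_def]
  have hpm : p ∈ Metric.closedBall p (min δ (min r₁ r₂)) :=
    Metric.mem_closedBall_self (lt_min hδ (lt_min hr₁ hr₂)).le
  have hpm' : p' ∈ Metric.closedBall p (min δ (min r₁ r₂)) := by
    rwa [Metric.mem_closedBall, dist_eq_norm]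
  -- The map `z ↦ add z v - z` has a derivative that vanishes for `v = 0`, because `add z 0 = z`.
  -- The derivative of `⊕` being Lipschitz, it is bounded by `C₂ * ‖v‖`.
  have key1 : ‖(add p v - p) - (add p' v - p')‖ ≤ C₂ * ‖v‖ * ‖p - p'‖ := by
    refine (convex_closedBall p (min δ (min r₁ r₂))).norm_image_sub_le_of_norm_hasFDerivWithin_le
      (𝕜 := ℝ) (f := fun z => add z v - z)
      (f' := fun z => (fderiv ℝ f (z, v)).comp (ContinuousLinearMap.inl ℝ E F) -
        ContinuousLinearMap.id ℝ E) (fun z hz => ?_) (fun z hz => ?_) hpm' hpm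
    · have hzv := (H₂ (z, 0) ⟨hmem z hz, rfl⟩ (z, v) (z, 0) (by
        rw [hdiff z (hmem z hz)]
        exact hv.trans ((min_le_right _ _).trans (min_le_right _ _))) (by simpa using hr₂.le)).1
      have hd : HasFDerivAt f (fderiv ℝ f (z, v)) (z, v) :=
        ((h.smooth_add.contDiffAt (hO.mem_nhds hzv)).differentiableAt two_ne_zero).hasFDerivAt
      have hd2 : HasFDerivAt (fun z : E => (z, v)) (ContinuousLinearMap.inl ℝ E F) z :=
        hasFDerivAt_prodMk_left z v
      exact ((hd.comp z hd2).sub (hasFDerivAt_id z)).hasFDerivWithinAt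
    · have hzK := hmem z hz
      have hz0 : ((z, 0) : E × F) ∈ V ×ˢ W := ⟨hK₁V hzK, h0W⟩
      have hd : HasFDerivAt f (fderiv ℝ f (z, 0)) (z, 0) :=
        ((h.smooth_add.contDiffAt (hO.mem_nhds hz0)).differentiableAt two_ne_zero).hasFDerivAt
      have hd2 : HasFDerivAt (fun z : E => (z, (0 : F))) (ContinuousLinearMap.inl ℝ E F) z :=
        hasFDerivAt_prodMk_left z 0
      have hid : (fderiv ℝ f (z, 0)).comp (ContinuousLinearMap.inl ℝ E F) =
          ContinuousLinearMap.id ℝ E := by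
        refine (hd.comp z hd2).unique ((hasFDerivAt_id z).congr_of_eventuallyEq ?_)
        filter_upwards [h.isOpen_points.mem_nhds (hK₁V hzK)] with y hy
        exact h.add_zero hy
      rw [← hid, ← ContinuousLinearMap.sub_comp]
      have hl := (H₂ (z, 0) ⟨hzK, rfl⟩ (z, v) (z, 0) (by
        rw [hdiff z hzK]
        exact hv.trans ((min_le_right _ _).trans (min_le_right _ _))) (by simpa using hr₂.le)).2
      rw [hdiff z hzK] at hl
      refine (ContinuousLinearMap.opNorm_comp_le _ _).trans ?_
      refine (mul_le_of_le_one_right (norm_nonneg _)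
        (ContinuousLinearMap.norm_inl_le_one ℝ E F)).trans hl
  have key2 : ‖add p' v - add p' v'‖ ≤ C₁ * ‖v - v'‖ := by
    have hl := (H₁ (p', 0) ⟨hmem p' hpm', rfl⟩ (p', v) (p', v') (by
        rw [hdiff p' (hmem p' hpm')]
        exact hv.trans ((min_le_right _ _).trans (min_le_left _ _))) (by
        rw [hdiff p' (hmem p' hpm')]
        exact hv'.trans ((min_le_right _ _).trans (min_le_left _ _)))).2
    have e : ‖(p', v) - (p', v')‖ = ‖v - v'‖ := by simp [Prod.norm_def]
    rwa [e] at hl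
  have e : add p v - add p' v' - (p - p') =
      ((add p v - p) - (add p' v - p')) + (add p' v - add p' v') := by abel
  rw [e, mul_add, ← mul_assoc]
  refine (norm_add_le _ _).trans (add_le_add (key1.trans ?_) (key2.trans ?_))
  · gcongr; exact le_max_right _ _
  · gcongr; exact le_max_left _ _

end PointVector

/-! ### Local shift-equivariant rules. -/

section LocalRules

theorem ValuedIn.translate {E : Type*} {U : Set E} {c : ℤ → E} (hc : ValuedIn U c) (s : ℤ) :
    ValuedIn U fun l => c (l + s) := fun _ => hc _

variable {E : Type*} [NormedAddCommGroup E] [NormedSpace ℝ E] {V : Set E}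
  {T : (ℤ → E) → ℤ → E}

/-- Every entry of `T c` is the entry with index `0` or `1` of `T` applied to a translate. -/
def EntriesReduce (V : Set E) (T : (ℤ → E) → ℤ → E) : Prop :=
  ∀ k : ℤ, ∃ i s : ℤ, (i = 0 ∨ i = 1) ∧ ∀ c, ValuedIn V c → T c k = T (fun l => c (l + s)) i

theorem translate_equivariant {E : Type*} {V : Set E} {T : (ℤ → E) → ℤ → E} {a b : ℤ}
    (h : ∀ c, ValuedIn V c → ∀ i, T (fun l => c (l + a)) i = T c (i + b)) (n : ℤ) :
    ∀ c, ValuedIn V c → ∀ i, T (fun l => c (l + a * n)) i = T c (i + b * n) := by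
  induction n with
  | zero => intro c hc i; simp
  | succ n ih =>
    intro c hc i
    have e : (fun l => c (l + a * (n + 1))) = fun l => (fun l => c (l + a * n)) (l + a) := by
      funext l; congr 1; ring
    rw [e, h _ (hc.translate _), ih c hc]
    congr 1; ring
  | pred n ih =>
    intro c hc i
    have h1 := h (fun l => c (l + a * (-n - 1))) (hc.translate _) (i - b)
    have e : (fun l => c (l + a + a * (-n - 1))) = fun l => c (l + a * -n) := by
      funext l; congr 1; ring
    rw [e, sub_add_cancel, ih c hc] at h1
    rw [← h1]; congr 1; ring

theorem IsUpscaling.apply_translate (h : IsUpscaling V T) {c : ℤ → E} (hc : ValuedIn V c)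
    (n i : ℤ) : T (fun l => c (l + n)) i = T c (i + 2 * n) := by
  have := translate_equivariant (T := T) (a := 1) (b := 2) (fun c hc i => by
    have := congrFun (h.shift_comm c hc) i
    simp only [shift, add_assoc] at this
    exact this) n c hc i
  simpa using this

theorem IsDownscaling.apply_translate (h : IsDownscaling V T) {c : ℤ → E} (hc : ValuedIn V c)
    (n i : ℤ) : T (fun l => c (l + 2 * n)) i = T c (i + n) := by
  have := translate_equivariant (T := T) (a := 2) (b := 1) (fun c hc i => by
    have e : (fun l => c (l + 2)) = shift (shift c) := by
      funext l; simp only [shift]; congr 1; ring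
    rw [e]
    exact congrFun (h.shift_comm c hc) i) n c hc i
  simpa using this

/-- A local rule may have a different window and window function for every index. Reduction to the
indices `0` and `1` is what makes bounds uniform in the index. -/
theorem IsUpscaling.entriesReduce (h : IsUpscaling V T) : EntriesReduce V T := fun k =>
  ⟨k % 2, k / 2, Int.emod_two_eq k, fun c hc => by
    rw [h.apply_translate hc, Int.emod_add_mul_ediv]⟩

theorem IsDownscaling.entriesReduce (h : IsDownscaling V T) : EntriesReduce V T := fun k =>
  ⟨0, 2 * k, Or.inl rfl, fun c hc => by rw [h.apply_translate hc, zero_add]⟩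

theorem IsLocalSmooth.locality (h : IsLocalSmooth V T) (k : ℤ) :
    ∃ m : ℕ, ∀ c c', ValuedIn V c → ValuedIn V c' → (∀ l : ℤ, |l| ≤ m → c l = c' l) →
      T c k = T c' k := by
  obtain ⟨m, φ, _, h⟩ := h k
  refine ⟨m, fun c c' hc hc' hcc => ?_⟩
  rw [h c hc, h c' hc']
  refine congrArg φ (funext fun i => hcc _ ?_)
  rw [abs_le]
  have := i.2
  omega

/-- A local smooth rule maps data in a compact set to data in a compact set. -/
theorem EntriesReduce.exists_isCompact_image (he : EntriesReduce V T) (h : IsLocalSmooth V T)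
    (hT : ∀ c, ValuedIn V c → ValuedIn V (T c)) {K : Set E} (hK : IsCompact K) (hKV : K ⊆ V) :
    ∃ K' : Set E, IsCompact K' ∧ K' ⊆ V ∧ ∀ c, ValuedIn K c → ValuedIn K' (T c) := by
  have entry : ∀ k : ℤ, ∃ K' : Set E, IsCompact K' ∧ K' ⊆ V ∧ ∀ c, ValuedIn K c → T c k ∈ K' := by
    intro k
    obtain ⟨m, φ, hφ, hk⟩ := h k
    refine ⟨φ '' Set.univ.pi fun _ => K, ?_, ?_, ?_⟩
    · exact (isCompact_univ_pi fun _ => hK).image_of_continuousOn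
        (hφ.continuousOn.mono (Set.pi_mono fun _ _ => hKV))
    · rintro _ ⟨u, hu, rfl⟩
      -- The window is extended to a sequence by repeating its end values, so that `φ u` becomes an
      -- entry of `T c` with `c` valued in `V`.
      set c : ℤ → E := fun l => u ⟨min (l + m).toNat (2 * m), by omega⟩ with hc
      have hcV : ValuedIn V c := fun l => hKV (hu _ trivial)
      have e : φ u = T c k := by
        rw [hk c hcV]
        congr 1
        funext i
        simp only [hc]
        congr 1
        ext
        have := i.2
        simp only
        omega
      rw [e]
      exact hT c hcV k
    · intro c hc
      exact ⟨_, fun i _ => hc _, (hk c fun i => hKV (hc i)).symm⟩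
  obtain ⟨K₀, hK₀, hK₀V, h₀⟩ := entry 0
  obtain ⟨K₁, hK₁, hK₁V, h₁⟩ := entry 1
  refine ⟨K₀ ∪ K₁, hK₀.union hK₁, Set.union_subset hK₀V hK₁V, fun c hc k => ?_⟩
  obtain ⟨i, s, rfl | rfl, hi⟩ := he k
  · rw [hi c fun i => hKV (hc i)]; exact Or.inl (h₀ _ (hc.translate s))
  · rw [hi c fun i => hKV (hc i)]; exact Or.inr (h₁ _ (hc.translate s))

/-- A local smooth rule is Lipschitz for the sup norm near data in a compact set. -/
theorem EntriesReduce.exists_lipschitz [FiniteDimensional ℝ E] (he : EntriesReduce V T)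
    (h : IsLocalSmooth V T) (hV : IsOpen V) {K : Set E} (hK : IsCompact K) (hKV : K ⊆ V) :
    ∃ r C : ℝ, 0 < r ∧ 0 ≤ C ∧ ∀ c c' : ℤ → E, ValuedIn K c → ∀ ε ≤ r,
      (∀ i, ‖c i - c' i‖ ≤ ε) → ValuedIn V c' ∧ ∀ k, ‖T c k - T c' k‖ ≤ C * ε := by
  obtain ⟨r, K₁, hr, hK₁, hK₁V, hball⟩ := exists_isCompact_closedBall_subset hK hV hKV
  have entry : ∀ k : ℤ, ∃ δ C : ℝ, 0 < δ ∧ 0 ≤ C ∧ ∀ c c' : ℤ → E, ValuedIn K c →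
      ValuedIn V c' → ∀ ε ≤ δ, (∀ i, ‖c i - c' i‖ ≤ ε) → ‖T c k - T c' k‖ ≤ C * ε := by
    intro k
    obtain ⟨m, φ, hφ, hk⟩ := h k
    obtain ⟨δ, C, hδ, hC, H⟩ := exists_lipschitz_near_compact (isCompact_univ_pi fun _ => hK)
      (isOpen_set_pi Set.finite_univ fun _ _ => hV) (Set.pi_mono fun _ _ => hKV)
      (hφ.of_le one_le_two)
    refine ⟨δ, C, hδ, hC, fun c c' hc hc' ε hε hcc => ?_⟩
    have hε0 : 0 ≤ ε := (norm_nonneg _).trans (hcc 0)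
    rw [hk c fun i => hKV (hc i), hk c' hc']
    set u : Fin (2 * m + 1) → E := fun i => c ((i : ℤ) - m) with hu
    set u' : Fin (2 * m + 1) → E := fun i => c' ((i : ℤ) - m) with hu'
    have huu : ‖u - u'‖ ≤ ε := (pi_norm_le_iff_of_nonneg hε0).2 fun i => hcc _
    have := (H u (fun i _ => hc _) u u' (by simpa using hδ.le)
      (by rw [norm_sub_rev]; exact huu.trans hε)).2
    exact this.trans (mul_le_mul_of_nonneg_left huu hC)
  obtain ⟨δ₀, C₀, hδ₀, hC₀, h₀⟩ := entry 0
  obtain ⟨δ₁, C₁, hδ₁, hC₁, h₁⟩ := entry 1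
  refine ⟨min r (min δ₀ δ₁), max C₀ C₁, lt_min hr (lt_min hδ₀ hδ₁), le_max_of_le_left hC₀,
    fun c c' hc ε hε hcc => ?_⟩
  have hε0 : 0 ≤ ε := (norm_nonneg _).trans (hcc 0)
  have hc' : ValuedIn V c' := fun i => hK₁V (hball (c i) (hc i) (by
    rw [Metric.mem_closedBall, dist_comm, dist_eq_norm]
    exact (hcc i).trans (hε.trans (min_le_left _ _))))
  refine ⟨hc', fun k => ?_⟩
  obtain ⟨i, s, rfl | rfl, hi⟩ := he k
  · rw [hi c fun i => hKV (hc i), hi c' hc']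
    refine (h₀ _ _ (hc.translate s) (hc'.translate s) ε
      (hε.trans ((min_le_right _ _).trans (min_le_left _ _))) fun _ => hcc _).trans ?_
    gcongr; exact le_max_left _ _
  · rw [hi c fun i => hKV (hc i), hi c' hc']
    refine (h₁ _ _ (hc.translate s) (hc'.translate s) ε
      (hε.trans ((min_le_right _ _).trans (min_le_right _ _))) fun _ => hcc _).trans ?_
    gcongr; exact le_max_right _ _

end LocalRules

/-! ### Prediction errors of slowly varying data. -/

section Prediction

variable {E : Type*} [NormedAddCommGroup E] [NormedSpace ℝ E] [FiniteDimensional ℝ E]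
  {V : Set E} {S D : (ℤ → E) → ℤ → E}

/-- Up to a factor, the prediction error `c - S D c` is bounded by the differences of `c`. -/
theorem exists_prediction_estimate (hV : IsOpen V) (hS : IsUpscaling V S) (hD : IsDownscaling V D)
    (hSc : ReproducesConstants V S) (hDc : ReproducesConstants V D) {K : Set E}
    (hK : IsCompact K) (hKV : K ⊆ V) :
    ∃ r C : ℝ, 0 < r ∧ 0 ≤ C ∧ ∀ c : ℤ → E, ValuedIn K c → ValuedIn V (D c) → ∀ η ≤ r,
      (∀ i, ‖fwdDiffSeq c i‖ ≤ η) → ∀ k, ‖c k - S (D c) k‖ ≤ C * η := by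
  obtain ⟨rS, CS, hrS, hCS, HS⟩ := hS.entriesReduce.exists_lipschitz hS.localSmooth hV hK hKV
  obtain ⟨rD, CD, hrD, hCD, HD⟩ := hD.entriesReduce.exists_lipschitz hD.localSmooth hV hK hKV
  have entry : ∀ i : ℤ, ∃ r C : ℝ, 0 < r ∧ 0 ≤ C ∧ ∀ c : ℤ → E, ValuedIn K c →
      ValuedIn V (D c) → ∀ η ≤ r, (∀ i, ‖fwdDiffSeq c i‖ ≤ η) → ‖c i - S (D c) i‖ ≤ C * η := by
    intro i
    obtain ⟨mS, hmS⟩ := hS.localSmooth.locality i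
    choose mD hmD using hD.localSmooth.locality
    -- A radius large enough for all entries of `c` on which `S (D c) i` depends, and for the index
    -- `i` itself.
    set M : ℕ := i.natAbs + ∑ l ∈ Finset.Icc (-(mS : ℤ)) mS, mD l with hM
    have hMD : ∀ l : ℤ, |l| ≤ mS → mD l ≤ M := fun l hl =>
      (Finset.single_le_sum (f := mD) (fun _ _ => Nat.zero_le _)
        (Finset.mem_Icc.2 (abs_le.1 hl))).trans (Nat.le_add_left _ _)
    refine ⟨min (rD / (M + 1)) (rS / (CD * M + 1)), M + CS * (CD * M),
      lt_min (by positivity) (by positivity), by positivity, fun c hc hDcV η hη hΔ => ?_⟩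
    have hη0 : 0 ≤ η := (norm_nonneg _).trans (hΔ 0)
    have hη1 : M * η ≤ rD := by
      have := hη.trans (min_le_left _ _)
      rw [le_div_iff₀ (by positivity)] at this
      linarith
    have hη2 : CD * (M * η) ≤ rS := by
      have := hη.trans (min_le_right _ _)
      rw [le_div_iff₀ (by positivity)] at this
      linarith
    -- Even slowly varying data can drift far from `c 0`. Freezing `c` outside the window leaves `S
    -- (D c) i` unchanged and makes the data globally `M * η`-close to a constant, which `S` and `D`
    -- both fix.
    set c' : ℤ → E := fun l => c (max (-M) (min l M)) with hc'
    have hc'K : ValuedIn K c' := fun l => hc _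
    have h0 : c 0 ∈ V := hKV (hc 0)
    have h1 : ∀ l, ‖c 0 - c' l‖ ≤ M * η := fun l => by
      rw [norm_sub_rev]
      refine norm_sub_le_of_fwdDiffSeq_le hΔ M 0 _ ?_
      rw [sub_zero, abs_le]; omega
    have hconst : ValuedIn K fun _ : ℤ => c 0 := fun _ => hc 0
    have h2 := (HD (fun _ => c 0) c' hconst _ hη1 h1).2
    rw [hDc _ h0] at h2
    obtain ⟨hV', h3⟩ := HS (fun _ => c 0) (D c') hconst _ hη2 h2
    rw [hSc _ h0] at h3
    have hloc : S (D c) i = S (D c') i := by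
      refine hmS _ _ hDcV hV' fun l hl => hmD l _ _ (fun i => hKV (hc i))
        (fun i => hKV (hc'K i)) fun n hn => ?_
      have h4 := hMD l hl
      rw [abs_le] at hn
      simp only [hc']
      congr 1
      omega
    have h5 : ‖c i - c 0‖ ≤ M * η := by
      refine norm_sub_le_of_fwdDiffSeq_le hΔ M 0 _ ?_
      rw [sub_zero, hM, Int.abs_eq_natAbs]; omega
    rw [hloc]
    calc ‖c i - S (D c') i‖ = ‖(c i - c 0) + (c 0 - S (D c') i)‖ := by rw [sub_add_sub_cancel]
      _ ≤ M * η + CS * (CD * (M * η)) := (norm_add_le _ _).trans (add_le_add h5 (h3 i))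
      _ = _ := by ring
  obtain ⟨r₀, C₀, hr₀, hC₀, H₀⟩ := entry 0
  obtain ⟨r₁, C₁, hr₁, hC₁, H₁⟩ := entry 1
  refine ⟨min r₀ r₁, max C₀ C₁, lt_min hr₀ hr₁, le_max_of_le_left hC₀,
    fun c hc hDcV η hη hΔ k => ?_⟩
  have hη0 : 0 ≤ η := (norm_nonneg _).trans (hΔ 0)
  have hcV : ValuedIn V c := fun i => hKV (hc i)
  -- Translation by an even number commutes with `S ∘ D`, so index `k` reduces to its parity.
  set c' : ℤ → E := fun l => c (l + 2 * (k / 2)) with hc'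
  have hΔ' : ∀ i, ‖fwdDiffSeq c' i‖ ≤ η := fun i => by
    have := hΔ (i + 2 * (k / 2))
    simp only [fwdDiffSeq, hc'] at this ⊢
    rwa [add_right_comm] at this
  have hD' : D c' = fun i => D c (i + k / 2) := funext fun i => hD.apply_translate hcV _ i
  have hD'V : ValuedIn V (D c') := by rw [hD']; exact hDcV.translate _
  have hS' : ∀ i, S (D c') i = S (D c) (i + 2 * (k / 2)) := fun i => by
    rw [hD']; exact hS.apply_translate hDcV _ i
  have e := Int.emod_add_mul_ediv k 2
  rcases Int.emod_two_eq k with h | h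
  · have := H₀ c' (hc.translate _) hD'V η (hη.trans (min_le_left _ _)) hΔ'
    rw [hS'] at this
    simp only [hc'] at this
    rw [← h, e] at this
    exact this.trans (mul_le_mul_of_nonneg_right (le_max_left _ _) hη0)
  · have := H₁ c' (hc.translate _) hD'V η (hη.trans (min_le_right _ _)) hΔ'
    rw [hS'] at this
    simp only [hc'] at this
    rw [← h, e] at this
    exact this.trans (mul_le_mul_of_nonneg_right (le_max_right _ _) hη0)

end Prediction

/-! ### Linearization of `S` at constant data. -/

section Linearization

variable {E : Type*} [NormedAddCommGroup E] [NormedSpace ℝ E]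
  {V : Set E} {S T : (ℤ → E) → ℤ → E}

/-- Restricting to lines turns the sup norm differential into one-variable derivatives of single
entries, which are unique and can be compared with those of the window function. -/
theorem HasSeqDifferentialAt.hasDerivAt {c e : ℤ → E} (h : HasSeqDifferentialAt S T c)
    (hT : ∀ (t : ℝ), T (t • e) = t • T e) (he : IsBdd e) (k : ℤ) :
    HasDerivAt (fun t : ℝ => S (c + t • e) k) (T e k) 0 := by
  obtain ⟨a, ha⟩ := he
  have ha0 : 0 ≤ a := (norm_nonneg _).trans (ha 0)
  rw [hasDerivAt_iff_isLittleO, Asymptotics.isLittleO_iff]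
  intro ε hε
  obtain ⟨δ, hδ, H⟩ := h (ε / (a + 1)).toNNReal (Real.toNNReal_pos.2 (by positivity))
  have hδ' : (0 : ℝ) < δ / (a + 1) := div_pos (NNReal.coe_pos.2 hδ) (by positivity)
  filter_upwards [Metric.ball_mem_nhds (0 : ℝ) hδ'] with t ht
  rw [Metric.mem_ball, dist_zero_right, Real.norm_eq_abs, lt_div_iff₀ (by positivity)] at ht
  have hta : ∀ i, ‖(t • e) i‖ ≤ |t| * a := fun i => by
    rw [Pi.smul_apply, norm_smul, Real.norm_eq_abs]
    exact mul_le_mul_of_nonneg_left (ha i) (abs_nonneg t)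
  have hn : seqNorm (t • e) ≤ ENNReal.ofReal (|t| * a) :=
    (seqNorm_le_ofReal_iff (by positivity)).2 hta
  have h1 := H (t • e) (hn.trans (by
    rw [← ENNReal.ofReal_coe_nnreal]
    refine ENNReal.ofReal_le_ofReal ?_
    have := abs_nonneg t
    linarith))
  have h2 : seqNorm (S (c + t • e) - S c - T (t • e)) ≤
      ENNReal.ofReal (ε / (a + 1) * (|t| * a)) := by
    refine h1.trans ?_
    rw [ENNReal.ofReal_mul (by positivity)]
    exact mul_le_mul_right hn _
  have h3 := (seqNorm_le_ofReal_iff (by positivity)).1 h2 k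
  rw [hT] at h3
  simp only [Pi.sub_apply, Pi.smul_apply] at h3
  simp only [sub_zero, zero_smul, add_zero, Real.norm_eq_abs]
  refine h3.trans ?_
  rw [div_mul_eq_mul_div, div_le_iff₀ (by positivity)]
  have : 0 ≤ ε * |t| := by positivity
  linarith

theorem eventually_valuedIn (hV : IsOpen V) {x : E} (hx : x ∈ V) {e : ℤ → E} (he : IsBdd e) :
    ∀ᶠ t : ℝ in 𝓝 0, ValuedIn V ((fun _ => x) + t • e) := by
  obtain ⟨a, ha⟩ := he
  have ha0 : 0 ≤ a := (norm_nonneg _).trans (ha 0)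
  obtain ⟨δ, hδ, hball⟩ := Metric.isOpen_iff.1 hV x hx
  have hδ' : 0 < δ / (a + 1) := by positivity
  filter_upwards [Metric.ball_mem_nhds (0 : ℝ) hδ'] with t ht i
  rw [Metric.mem_ball, dist_zero_right, Real.norm_eq_abs, lt_div_iff₀ (by positivity)] at ht
  refine hball ?_
  rw [Metric.mem_ball, dist_eq_norm, Pi.add_apply, add_sub_cancel_left, Pi.smul_apply, norm_smul,
    Real.norm_eq_abs]
  have := mul_le_mul_of_nonneg_left (ha i) (abs_nonneg t)
  have := abs_nonneg t
  linarith

/-- Along constants `S` is the identity, so its differential fixes constants. -/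
theorem differential_const (hV : IsOpen V) (hSc : ReproducesConstants V S) {x : E} (hx : x ∈ V)
    (h : HasSeqDifferentialAt S T fun _ => x) (hT : ∀ (t : ℝ) (e : ℤ → E), T (t • e) = t • T e)
    (y : E) : T (fun _ => y) = fun _ => y := by
  funext k
  have hb : IsBdd fun _ : ℤ => y := ⟨‖y‖, fun _ => le_rfl⟩
  refine (h.hasDerivAt (fun t => hT t _) hb k).unique ?_
  have h1 : HasDerivAt (fun t : ℝ => x + t • y) y 0 := by
    simpa using ((hasDerivAt_id (0 : ℝ)).smul_const y).const_add x
  refine h1.congr_of_eventuallyEq ?_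
  filter_upwards [eventually_valuedIn hV hx hb] with t ht
  exact congrFun (hSc (x + t • y) (ht 0)) k

/-- The differential at constant data, in terms of the function which computes an entry. -/
theorem fderiv_const_window (hV : IsOpen V) {k : ℤ} {m : ℕ} {φ : (Fin (2 * m + 1) → E) → E}
    (hφ : ContDiffOn ℝ 2 φ (Set.univ.pi fun _ => V))
    (hk : ∀ c, ValuedIn V c → S c k = φ (fun i => c ((i : ℤ) - (m : ℤ))))
    {x : E} (hx : x ∈ V) (h : HasSeqDifferentialAt S T fun _ => x)
    (hT : ∀ (t : ℝ) (e : ℤ → E), T (t • e) = t • T e) {e : ℤ → E} (he : IsBdd e) :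
    fderiv ℝ φ (fun _ => x) (fun i => e ((i : ℤ) - (m : ℤ))) = T e k := by
  refine HasDerivAt.unique ?_ (h.hasDerivAt (fun t => hT t e) he k)
  have hO : IsOpen (Set.univ.pi fun _ : Fin (2 * m + 1) => V) :=
    isOpen_set_pi Set.finite_univ fun _ _ => hV
  have hd : HasFDerivAt φ (fderiv ℝ φ fun _ => x) fun _ => x :=
    ((hφ.contDiffAt (hO.mem_nhds fun _ _ => hx)).differentiableAt two_ne_zero).hasFDerivAt
  have h1 : HasDerivAt (fun t : ℝ => (fun _ : Fin (2 * m + 1) => x) +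
      t • fun i : Fin (2 * m + 1) => e ((i : ℤ) - (m : ℤ)))
      (fun i : Fin (2 * m + 1) => e ((i : ℤ) - (m : ℤ))) 0 := by
    simpa using ((hasDerivAt_id (0 : ℝ)).smul_const
      (fun i : Fin (2 * m + 1) => e ((i : ℤ) - (m : ℤ)))).const_add
        (fun _ : Fin (2 * m + 1) => x)
  have h2 := hd.comp_hasDerivAt_of_eq (0 : ℝ) h1 (by simp)
  refine h2.congr_of_eventuallyEq ?_
  filter_upwards [eventually_valuedIn hV hx he] with t ht
  exact hk _ ht

/-- Linearization error of a local smooth rule whose differentials at constants are all equal: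
it is controlled by the differences of the data and of the perturbation. -/
theorem exists_linearization_entry [FiniteDimensional ℝ E] (hV : IsOpen V)
    (hS : IsLocalSmooth V S)
    (hd : ∀ x ∈ V, HasSeqDifferentialAt S T fun _ => x)
    (hT : ∀ (t : ℝ) (e : ℤ → E), T (t • e) = t • T e) {K : Set E} (hK : IsCompact K)
    (hKV : K ⊆ V) (k : ℤ) :
    ∃ r L : ℝ, 0 < r ∧ 0 ≤ L ∧ ∀ (b b' : ℤ → E) (η ε ζ : ℝ), ValuedIn K b → ValuedIn V b' →
      (∀ i, ‖fwdDiffSeq b i‖ ≤ η) → η ≤ r → (∀ i, ‖(b - b') i‖ ≤ ε) → ε ≤ r →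
      (∀ i, ‖fwdDiffSeq (b - b') i‖ ≤ ζ) → ζ ≤ r →
      ‖S b k - S b' k - T (b - b') k‖ ≤ L * (η + ζ) * ε := by
  obtain ⟨δ, K₁, hδ, hK₁, hK₁V, hball⟩ := exists_isCompact_closedBall_subset hK hV hKV
  obtain ⟨m, φ, hφ, hk⟩ := hS k
  have hO : IsOpen (Set.univ.pi fun _ : Fin (2 * m + 1) => V) :=
    isOpen_set_pi Set.finite_univ fun _ _ => hV
  obtain ⟨ρ, C, hρ, hC, H⟩ := exists_lipschitz_near_compact
    (isCompact_univ_pi fun _ : Fin (2 * m + 1) => hK₁) hO (Set.pi_mono fun _ _ => hK₁V)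
    (hφ.fderiv_of_isOpen hO (m := 1) (by norm_num))
  refine ⟨min δ (ρ / (2 * m + 1)), C * m, lt_min hδ (by positivity), by positivity, ?_⟩
  intro b b' η ε ζ hb hb' hη hηr hε hεr hζ hζr
  have hε0 : 0 ≤ ε := (norm_nonneg _).trans (hε 0)
  have hη0 : 0 ≤ η := (norm_nonneg _).trans (hη 0)
  have hζ0 : 0 ≤ ζ := (norm_nonneg _).trans (hζ 0)
  set u : Fin (2 * m + 1) → E := fun i => b ((i : ℤ) - m) with hu
  set u' : Fin (2 * m + 1) → E := fun i => b' ((i : ℤ) - m) with hu'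
  have hle : m * (η + ζ) ≤ ρ := by
    have h1 := hηr.trans (min_le_right _ _)
    have h2 := hζr.trans (min_le_right _ _)
    rw [le_div_iff₀ (by positivity)] at h1 h2
    linarith
  -- Every window extends to a bounded sequence, on which the derivative of `φ` is given by `T`,
  -- whatever the constant.
  have hLsame : ∀ x ∈ V, ∀ y ∈ V, fderiv ℝ φ (fun _ => x) = fderiv ℝ φ (fun _ => y) := by
    intro x hx y hy
    ext w
    set e : ℤ → E := fun l => w ⟨min (l + m).toNat (2 * m), by omega⟩ with he
    have hw : w = fun i : Fin (2 * m + 1) => e ((i : ℤ) - m) := by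
      funext i
      simp only [he]
      congr 1
      ext
      have := i.2
      simp only
      omega
    have hbe : IsBdd e := ⟨‖w‖, fun i => norm_le_pi_norm w _⟩
    rw [hw, fderiv_const_window hV hφ hk hx (hd x hx) hT hbe,
      fderiv_const_window hV hφ hk hy (hd y hy) hT hbe]
  have hb0 : b 0 ∈ V := hKV (hb 0)
  have hbb : IsBdd (b - b') := ⟨ε, hε⟩
  have hT' : T (b - b') k = fderiv ℝ φ (fun _ => b 0) (u - u') :=
    (fderiv_const_window hV hφ hk hb0 (hd _ hb0) hT hbb).symm
  -- Each point of the segment is close to a constant window, but the constant moves along with the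
  -- point; by `hLsame` the derivative of `φ` at these constants does not change. The mean value
  -- inequality on the segment then gives `key`.
  have hseg : ∀ z ∈ segment ℝ u' u, ∃ y ∈ K₁, ‖z - fun _ => y‖ ≤ m * (η + ζ) := by
    rintro z ⟨s, t, hs, ht, hst, rfl⟩
    have hs1 : s ≤ 1 := by linarith
    refine ⟨b 0 - s • (b - b') 0, hball (b 0) (hb 0) ?_, ?_⟩
    · rw [Metric.mem_closedBall, dist_eq_norm, sub_sub_cancel_left, norm_neg, norm_smul,
        Real.norm_of_nonneg hs]
      exact (mul_le_of_le_one_left (norm_nonneg _) hs1).trans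
        ((hε 0).trans (hεr.trans (min_le_left _ _)))
    · refine (pi_norm_le_iff_of_nonneg (by positivity)).2 fun i => ?_
      have hi : |(i : ℤ) - m - 0| ≤ m := by
        have := i.2
        rw [abs_le]; omega
      have h1 := norm_sub_le_of_fwdDiffSeq_le hη m 0 _ hi
      have h2 := norm_sub_le_of_fwdDiffSeq_le hζ m 0 _ hi
      have e : (s • u' + t • u - (fun _ => b 0 - s • (b - b') 0) : Fin (2 * m + 1) → E) i =
          (b ((i : ℤ) - m) - b 0) - s • ((b - b') ((i : ℤ) - m) - (b - b') 0) := by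
        have ht' : t = 1 - s := by linarith
        simp only [hu, hu', Pi.sub_apply, Pi.add_apply, Pi.smul_apply, ht']
        module
      rw [e, mul_add]
      refine (norm_sub_le _ _).trans (add_le_add h1 ?_)
      rw [norm_smul, Real.norm_of_nonneg hs]
      exact (mul_le_of_le_one_left (norm_nonneg _) hs1).trans h2
  have huu : ‖u - u'‖ ≤ ε := (pi_norm_le_iff_of_nonneg hε0).2 fun i => hε _
  have key : ‖(φ u - fderiv ℝ φ (fun _ => b 0) u) - (φ u' - fderiv ℝ φ (fun _ => b 0) u')‖ ≤
      C * (m * (η + ζ)) * ‖u - u'‖ := by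
    refine (convex_segment u' u).norm_image_sub_le_of_norm_hasFDerivWithin_le
      (𝕜 := ℝ) (f := fun z => φ z - fderiv ℝ φ (fun _ => b 0) z)
      (f' := fun z => fderiv ℝ φ z - fderiv ℝ φ (fun _ => b 0)) (fun z hz => ?_) (fun z hz => ?_)
      (left_mem_segment ℝ u' u) (right_mem_segment ℝ u' u)
    · obtain ⟨y, hy, hzy⟩ := hseg z hz
      have hzV := (H (fun _ => y) (fun _ _ => hy) z z (hzy.trans hle) (hzy.trans hle)).1
      exact ((((hφ.contDiffAt (hO.mem_nhds hzV)).differentiableAt two_ne_zero).hasFDerivAt).sub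
        (fderiv ℝ φ (fun _ => b 0)).hasFDerivAt).hasFDerivWithinAt
    · obtain ⟨y, hy, hzy⟩ := hseg z hz
      rw [hLsame _ hb0 _ (hK₁V hy)]
      exact (H (fun _ => y) (fun _ _ => hy) z (fun _ => y) (hzy.trans hle)
        (by simpa using hρ.le)).2.trans (mul_le_mul_of_nonneg_left hzy hC)
  rw [hk b fun i => hKV (hb i), hk b' hb', hT', map_sub]
  have e : φ u - φ u' - (fderiv ℝ φ (fun _ => b 0) u - fderiv ℝ φ (fun _ => b 0) u') =
    (φ u - fderiv ℝ φ (fun _ => b 0) u) - (φ u' - fderiv ℝ φ (fun _ => b 0) u') := by abel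
  rw [e]
  have hc : 0 ≤ C * (m * (η + ζ)) := by positivity
  exact (key.trans (mul_le_mul_of_nonneg_left huu hc)).trans (le_of_eq (by ring))

/-- `T` linearizes `S` near slowly varying data in `K`, up to errors which are controlled by the
differences of the data and by the seminorm `q` of the perturbation. -/
def LinearizedBy (V K : Set E) (S T : (ℤ → E) → ℤ → E) (q : (ℤ → E) → ℝ) : Prop :=
  ∃ r L : ℝ, 0 < r ∧ 0 ≤ L ∧ ∀ (b b' : ℤ → E) (η ε : ℝ), ValuedIn K b → ValuedIn V b' →
    (∀ i, ‖fwdDiffSeq b i‖ ≤ η) → η ≤ r → (∀ i, ‖(b - b') i‖ ≤ ε) → ε ≤ r →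
    ∀ k, ‖S b k - S b' k - T (b - b') k‖ ≤ L * (η + q (b - b')) * ε

theorem linearizedBy_upscale [FiniteDimensional ℝ E] (hV : IsOpen V) (hS : IsUpscaling V S)
    {α : ℤ →₀ ℝ} (hd : ∀ x ∈ V, HasSeqDifferentialAt S (upscale α) fun _ => x)
    {q : (ℤ → E) → ℝ} (hq : ∀ x, IsBdd x → ∀ i, ‖fwdDiffSeq x i‖ ≤ q x)
    {K : Set E} (hK : IsCompact K) (hKV : K ⊆ V) : LinearizedBy V K S (upscale α) q := by
  have entry := exists_linearization_entry hV hS.localSmooth hd (upscale_smul α) hK hKV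
  obtain ⟨r₀, L₀, hr₀, hL₀, H₀⟩ := entry 0
  obtain ⟨r₁, L₁, hr₁, hL₁, H₁⟩ := entry 1
  refine ⟨min r₀ r₁ / 2, max L₀ L₁, half_pos (lt_min hr₀ hr₁), le_max_of_le_left hL₀, ?_⟩
  intro b b' η ε hb hb' hη hηr hε hεr k
  have hr : 0 < min r₀ r₁ := lt_min hr₀ hr₁
  have hε0 : 0 ≤ ε := (norm_nonneg _).trans (hε 0)
  have hη0 : 0 ≤ η := (norm_nonneg _).trans (hη 0)
  have hbb : IsBdd (b - b') := ⟨ε, hε⟩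
  -- The first entry gives the desired estimate. The second makes `ζ` small enough for `H₀` and
  -- `H₁`, although `q (b - b')` itself need not be small.
  set ζ := min (q (b - b')) (2 * ε) with hζdef
  have hζ : ∀ i, ‖fwdDiffSeq (b - b') i‖ ≤ ζ := fun i => le_min (hq _ hbb i) (by
    refine (norm_sub_le _ _).trans ?_
    have := hε (i + 1); have := hε i
    linarith)
  have hζ0 : 0 ≤ ζ := (norm_nonneg _).trans (hζ 0)
  have hζr : ζ ≤ min r₀ r₁ := (min_le_right _ _).trans (by linarith)
  have fin : ∀ L, L ≤ max L₀ L₁ → L * (η + ζ) * ε ≤ max L₀ L₁ * (η + q (b - b')) * ε := by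
    intro L hL
    refine mul_le_mul_of_nonneg_right (mul_le_mul hL ?_ (by positivity)
      (le_max_of_le_left hL₀)) hε0
    exact add_le_add_right (min_le_left _ _) η
  set n := k / 2 with hn
  have e := Int.emod_add_mul_ediv k 2
  have tr : ∀ c : ℤ → E, ValuedIn V c → ∀ i, i = k % 2 → S (fun l => c (l + n)) i = S c k := by
    rintro c hc i rfl
    rw [hS.apply_translate hc, e]
  have trT : ∀ i, i = k % 2 → upscale α ((fun l => b (l + n)) - fun l => b' (l + n)) i =
      upscale α (b - b') k := by
    rintro i rfl
    have h := congrFun (upscale_translate α (b - b') (-n)) (k % 2)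
    simp only [sub_neg_eq_add, mul_neg] at h
    rw [e] at h
    exact h
  have hbV : ValuedIn V b := fun i => hKV (hb i)
  have hη' : ∀ i, ‖fwdDiffSeq (fun l => b (l + n)) i‖ ≤ η := fun i => by
    have := hη (i + n)
    simp only [fwdDiffSeq] at this ⊢
    rwa [add_right_comm] at this
  have hζ' : ∀ i, ‖fwdDiffSeq ((fun l => b (l + n)) - fun l => b' (l + n)) i‖ ≤ ζ := fun i => by
    have := hζ (i + n)
    simp only [fwdDiffSeq, Pi.sub_apply] at this ⊢
    rwa [add_right_comm] at this
  rcases Int.emod_two_eq k with h | h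
  · have := H₀ _ _ η ε ζ (hb.translate n) (hb'.translate n) hη' (by
      have := min_le_left r₀ r₁; linarith) (fun i => hε (i + n)) (by
      have := min_le_left r₀ r₁; linarith) hζ' (hζr.trans (min_le_left _ _))
    rw [tr b hbV 0 h.symm, tr b' hb' 0 h.symm, trT 0 h.symm] at this
    exact this.trans (fin _ (le_max_left _ _))
  · have := H₁ _ _ η ε ζ (hb.translate n) (hb'.translate n) hη' (by
      have := min_le_right r₀ r₁; linarith) (fun i => hε (i + n)) (by
      have := min_le_right r₀ r₁; linarith) hζ' (hζr.trans (min_le_right _ _))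
    rw [tr b hbV 1 h.symm, tr b' hb' 1 h.symm, trT 1 h.symm] at this
    exact this.trans (fin _ (le_max_right _ _))

theorem linearizedBy_splitting {E : Type*} [NormedAddCommGroup E] {V : Set E}
    {S : (ℤ → E) → ℤ → E} (hS : IsSplittingRule V S) {K : Set E} (hKV : K ⊆ V) :
    LinearizedBy V K S (fun c k => c (k / 2)) fun _ => 0 := by
  refine ⟨1, 0, one_pos, le_rfl, ?_⟩
  intro b b' η ε hb hb' _ _ _ _ k
  have h : ∀ c, ValuedIn V c → S c k = c (k / 2) := by
    intro c hc
    have e := Int.emod_add_mul_ediv k 2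
    rcases Int.emod_two_eq k with h | h
    · rw [← (hS c hc (k / 2)).1]; congr 1; omega
    · rw [← (hS c hc (k / 2)).2]; congr 1; omega
  rw [h b fun i => hKV (hb i), h b' hb']
  change ‖b (k / 2) - b' (k / 2) - (b (k / 2) - b' (k / 2))‖ ≤ _
  rw [sub_self, norm_zero, zero_mul, zero_mul]

/-- In the convergent case as well as in the Haar case, the operator `S` has a linearization with
adapted norms. -/
theorem exists_adapted_linearization [FiniteDimensional ℝ E] [Nontrivial E] (hV : IsOpen V)
    (hS : IsUpscaling V S) (hSc : ReproducesConstants V S)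
    (hSlin : (∃ α : ℤ →₀ ℝ, IsConvergentSubdivision α ∧
      ∀ x ∈ V, HasSeqDifferentialAt S (upscale α) (fun _ => x)) ∨ IsSplittingRule V S)
    {K : Set E} (hK : IsCompact K) (hKV : K ⊆ V) (hKne : K.Nonempty) :
    ∃ T p q C γ, AdaptedNorms T p q C γ ∧ LinearizedBy V K S T q := by
  rcases hSlin with ⟨α, hα, hd⟩ | hH
  -- The differential fixes constant vector sequences; a nonzero vector `y` transfers this to the
  -- scalar rule.
  · have hone : upscale α (fun _ => (1 : ℝ)) = fun _ => 1 := by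
      obtain ⟨x, hx⟩ := hKne
      obtain ⟨y, hy⟩ := exists_ne (0 : E)
      have h1 := differential_const hV hSc (hKV hx) (hd x (hKV hx)) (upscale_smul α) y
      have h2 := upscale_smul_const α (fun _ => 1) y
      simp only [one_smul] at h2
      rw [h1] at h2
      funext k
      have h3 := congrFun h2 k
      exact smul_left_injective ℝ hy (by simpa using h3.symm)
    obtain ⟨p, q, C, γ, hpq, hq⟩ := exists_adaptedNorms_upscale (E := E) hα hone
    exact ⟨_, p, q, C, γ, hpq, linearizedBy_upscale hV hS hd hq hK hKV⟩
  · exact ⟨_, _, _, _, _, adaptedNorms_splitting, linearizedBy_splitting hH hKV⟩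

end Linearization

/-! ### From one-step estimates to stability. -/

/-- Stability of a recursion whose steps are Lipschitz, and close to the operator `T` from the
level `J` on. -/
theorem stable_of_steps {E : Type*} [NormedAddCommGroup E] {T : (ℤ → E) → ℤ → E}
    {p q : (ℤ → E) → ℝ} {C γ : ℝ} (h : AdaptedNorms T p q C γ) {r L μ : ℝ} (hr : 0 < r)
    (hL : 0 ≤ L) (hμ0 : 0 ≤ μ) (hμ1 : μ < 1) (J : ℕ) :
    ∃ M E₁ E₂ : ℝ, 0 ≤ M ∧ 0 < E₁ ∧ 0 < E₂ ∧ ∀ (j : ℕ) (e : ℕ → ℤ → E) (s : ℕ → ℝ) (x : ℝ),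
      (∀ i, ‖e 0 i‖ ≤ x) → x ≤ E₁ → (∀ k, 0 ≤ s k) → (∀ k < j, s k ≤ E₂ * μ ^ k) →
      (∀ k < j, ∀ ε ≤ r, (∀ i, ‖e k i‖ ≤ ε) → s k ≤ r →
        ∀ i, ‖e (k + 1) i‖ ≤ L * (ε + s k)) →
      (∀ k < j, J ≤ k → ∀ ε ≤ r, (∀ i, ‖e k i‖ ≤ ε) → s k ≤ r →
        ∀ i, ‖(e (k + 1) - T (e k)) i‖ ≤ L * (μ ^ k + q (e k)) * ε + L * s k) →
      ∀ i, ‖e j i‖ ≤ M * (x + ∑ k ∈ Finset.range j, s k) := by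
  have hC := h.const_nonneg
  have hγ : 0 < 1 - γ := sub_pos.2 h.rate_lt_one
  -- One constant dominating both `C * L`, the factor in the error terms, and `C`, the bound for `q
  -- (e J)` used to start the coupled recursion.
  set G : ℝ := C * L + C with hG
  have hG0 : 0 ≤ G := by positivity
  set ρ : ℝ := min (min r 1) ((1 - γ) / (2 * G + 1)) with hρ
  have hρ0 : 0 < ρ := lt_min (lt_min hr one_pos) (by positivity)
  have hρr : ρ ≤ r := (min_le_left _ _).trans (min_le_left _ _)
  have hGρ : 2 * (G * ρ) ≤ 1 - γ := by
    have h1 : ρ ≤ (1 - γ) / (2 * G + 1) := min_le_right _ _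
    rw [le_div_iff₀ (by positivity)] at h1
    linarith
  have hμH : ∀ k, ∑ i ∈ Finset.range k, μ ^ (J + i) ≤ (1 - μ)⁻¹ := fun k => by
    refine (Finset.sum_le_sum fun i _ => pow_le_pow_of_le_one hμ0 hμ1.le
      (Nat.le_add_left i J)).trans ?_
    rw [← tsum_geometric_of_lt_one hμ0 hμ1]
    exact (summable_geometric_of_lt_one hμ0 hμ1).sum_le_tsum _ fun i _ => pow_nonneg hμ0 i
  obtain ⟨Eg, Mg, hEg, hMg, gron⟩ := coupled_gronwall hG0 h.rate_lt_one
    (inv_nonneg.2 (sub_pos.2 hμ1).le) hρ0 ((min_le_left _ _).trans (min_le_right _ _)) hGρ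
  obtain ⟨Ee, Me, hEe, hMe, early⟩ := finite_steps_stable hr (mul_nonneg hC hL) J
    (min Eg 1) (lt_min hEg one_pos)
  refine ⟨(Me + Mg * (Me + 1)) * (C + 1), Ee / (C + 1), min (min Ee Eg) r, by positivity,
    by positivity, lt_min (lt_min hEe hEg) hr, ?_⟩
  intro j e s x hx hxE hs hsE coarse fine
  have hx0 : 0 ≤ x := (norm_nonneg _).trans (hx 0)
  have hsE' : ∀ k < j, s k ≤ min (min Ee Eg) r := fun k hk =>
    (hsE k hk).trans (mul_le_of_le_one_right (lt_min (lt_min hEe hEg) hr).le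
      (pow_le_one₀ hμ0 hμ1.le))
  -- the sizes `p (e k)`, made nonnegative for unbounded data
  set a : ℕ → ℝ := fun k => max (p (e k)) 0 with ha
  have hap : ∀ k, IsBdd (e k) → a k = p (e k) := fun k hk =>
    max_eq_left ((norm_nonneg _).trans (h.norm_le hk 0))
  have ha0 : a 0 ≤ C * x := max_le (h.p_le hx) (by positivity)
  have hae : ∀ k, IsBdd (e k) → ∀ i, ‖e k i‖ ≤ a k := fun k hk i =>
    (h.norm_le hk i).trans (le_max_left _ _)
  have hearly := early j a s (fun k => IsBdd (e k)) (fun k => le_max_right _ _) hs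
    (fun k hk => (hsE' k hk).trans ((min_le_left _ _).trans (min_le_left _ _))) ⟨x, hx⟩
    (ha0.trans (by
      rw [le_div_iff₀ (by positivity)] at hxE
      linarith))
    (fun k hk hb har hsr => by
      have h1 := coarse k hk (a k) har (hae k hb) hsr
      have hb' : IsBdd (e (k + 1)) := ⟨_, h1⟩
      refine ⟨hb', ?_⟩
      rw [hap _ hb', mul_assoc]
      exact h.p_le h1)
  set total := ∑ k ∈ Finset.range j, s k
  have htotal : 0 ≤ total := Finset.sum_nonneg fun i _ => hs i
  have ha00 : 0 ≤ a 0 := le_max_right _ _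
  have hfin : ∀ M' ≤ Me + Mg * (Me + 1), M' * (a 0 + total) ≤
      (Me + Mg * (Me + 1)) * (C + 1) * (x + total) := by
    intro M' hM'
    rw [mul_assoc]
    refine mul_le_mul hM' ?_ (by positivity) (by positivity)
    have : 0 ≤ C * total := by positivity
    linarith
  intro i
  rcases Nat.lt_or_ge J j with hJj | hJj
  · obtain ⟨gJ, aJ, aJ'⟩ := hearly J le_rfl hJj.le
    have hqJ : q (e J) ≤ G := by
      have h1 := h.q_le (hae J gJ)
      have h2 : C * a J ≤ C * 1 := mul_le_mul_of_nonneg_left (aJ'.trans (min_le_right _ _)) hC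
      have h3 : 0 ≤ C * L := by positivity
      linarith
    -- The coupled recursion starts afresh at level `J`, where the early steps have made `p (e J)`
    -- small.
    obtain ⟨gj, hj⟩ := gron (j - J) (fun k => a (J + k)) (fun k => q (e (J + k)))
      (fun k => s (J + k)) (fun k => μ ^ (J + k)) (fun k => IsBdd (e (J + k)))
      (fun k => le_max_right _ _) (fun k => h.q_nonneg _) (fun k => hs _)
      (fun k => pow_nonneg hμ0 _) hμH
      (fun k hk => (hsE _ (by omega)).trans (mul_le_mul_of_nonneg_right
        ((min_le_left _ _).trans (min_le_right _ _)) (pow_nonneg hμ0 _)))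
      gJ (aJ'.trans (min_le_left _ _)) hqJ
      (fun k hk hb har => by
        have hkj : J + k < j := by omega
        have h1 := fine (J + k) hkj (Nat.le_add_right _ _) (a (J + k)) (har.trans hρr)
          (hae _ hb) ((hsE' _ hkj).trans (min_le_right _ _))
        have hρb : IsBdd (e (J + k + 1) - T (e (J + k))) := ⟨_, h1⟩
        have hTb := h.bdd_map hb
        have e1 : e (J + k + 1) = T (e (J + k)) + (e (J + k + 1) - T (e (J + k))) := by abel
        have hb' : IsBdd (e (J + k + 1)) := by rw [e1]; exact hTb.add hρb
        have hq0 := h.q_nonneg (e (J + k))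
        have hm0 := pow_nonneg hμ0 (J + k)
        have hak : 0 ≤ a (J + k) := le_max_right _ _
        have hCL : C * L ≤ G := by linarith
        have i1 : C * (L * (μ ^ (J + k) + q (e (J + k))) * a (J + k) + L * s (J + k)) ≤
            G * (μ ^ (J + k) + q (e (J + k))) * a (J + k) + G * s (J + k) := by
          have j1 : C * L * ((μ ^ (J + k) + q (e (J + k))) * a (J + k)) ≤
              G * ((μ ^ (J + k) + q (e (J + k))) * a (J + k)) :=
            mul_le_mul_of_nonneg_right hCL (by positivity)
          have j2 : C * L * s (J + k) ≤ G * s (J + k) := mul_le_mul_of_nonneg_right hCL (hs _)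
          linarith
        refine ⟨hb', ?_, ?_⟩
        · change a (J + k + 1) ≤ _
          rw [hap _ hb']
          have h2 := h.p_add hTb hρb
          rw [← e1] at h2
          have h3 := h.p_map hb
          have h4 := h.p_le h1
          rw [← hap _ hb] at h3
          linarith
        · change q (e (J + k + 1)) ≤ _
          have h2 := h.q_add hTb hρb
          rw [← e1] at h2
          have h3 := h.q_map hb
          have h4 := h.q_le h1
          linarith) (j - J) le_rfl
    have hJ : J + (j - J) = j := by omega
    simp only [hJ, Nat.add_zero] at gj hj
    refine (hae j gj i).trans (hj.trans (le_trans ?_ (hfin _ le_rfl)))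
    have hs1 : ∑ k ∈ Finset.range (j - J), s (J + k) ≤ total := by
      have := Finset.sum_range_add s J (j - J)
      rw [hJ] at this
      have h0 : 0 ≤ ∑ i ∈ Finset.range J, s i := Finset.sum_nonneg fun i _ => hs i
      linarith
    have hs2 : ∑ k ∈ Finset.range J, s k ≤ total :=
      Finset.sum_le_sum_of_subset_of_nonneg (Finset.range_mono hJj.le) fun i _ _ => hs i
    have h5 : a J ≤ Me * (a 0 + total) := aJ.trans (mul_le_mul_of_nonneg_left (by linarith) hMe)
    have h6 : Mg * (a J + ∑ k ∈ Finset.range (j - J), s (J + k)) ≤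
        Mg * (Me * (a 0 + total) + (a 0 + total)) :=
      mul_le_mul_of_nonneg_left (by linarith) hMg
    have h7 : 0 ≤ Me * (a 0 + total) := by positivity
    linarith
  · obtain ⟨gj, h1, _⟩ := hearly j hJj le_rfl
    refine (hae j gj i).trans (h1.trans (hfin _ ?_))
    have : 0 ≤ Mg * (Me + 1) := by positivity
    linarith

/-! ### One reconstruction step. -/

section Steps

variable {E F : Type*} [NormedAddCommGroup E] [NormedSpace ℝ E] [FiniteDimensional ℝ E]
  [NormedAddCommGroup F] [NormedSpace ℝ F] [FiniteDimensional ℝ F]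
  {V : Set E} {W : Set F} {add : E → F → E} {sub : E → E → F}
  {S : (ℤ → E) → ℤ → E} {R : (ℤ → F) → ℤ → F}

theorem IsBoundedRule.exists_le {F : Type*} [NormedAddCommGroup F] {W : Set F}
    {R : (ℤ → F) → ℤ → F} (h : IsBoundedRule W R) : ∃ C : ℝ, 0 ≤ C ∧
    ∀ w, ValuedIn W w → ∀ a : ℝ, (∀ i, ‖w i‖ ≤ a) → ∀ i, ‖R w i‖ ≤ C * a := by
  obtain ⟨C, hC⟩ := h
  refine ⟨C, C.2, fun w hw a ha => ?_⟩
  have ha0 : 0 ≤ a := (norm_nonneg _).trans (ha 0)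
  refine (seqNorm_le_ofReal_iff (by positivity)).1 ((hC w hw).trans ?_)
  rw [ENNReal.ofReal_mul C.coe_nonneg, ENNReal.ofReal_coe_nnreal]
  exact mul_le_mul_right ((seqNorm_le_ofReal_iff ha0).2 ha) _

/-- One reconstruction step is Lipschitz near data in compact sets. -/
theorem exists_coarse_step (hpv : IsPointVectorPair V W add sub) (hS : IsUpscaling V S)
    (hR : IsUpscaling W R) (hRW : ∀ w, ValuedIn W w → ValuedIn W (R w))
    {K : Set E} (hK : IsCompact K) (hKV : K ⊆ V) {K' : Set F} (hK' : IsCompact K')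
    (hKW : K' ⊆ W) :
    ∃ r L : ℝ, 0 < r ∧ 0 ≤ L ∧ ∀ (b b' : ℤ → E) (d d' : ℤ → F) (ε s : ℝ), ValuedIn K b →
      ValuedIn K (S b) → ValuedIn K' d → (∀ i, ‖(b - b') i‖ ≤ ε) → ε ≤ r →
      (∀ i, ‖(d - d') i‖ ≤ s) → s ≤ r →
      ∀ i, ‖(seqAdd add (S b) (R d) - seqAdd add (S b') (R d')) i‖ ≤ L * (ε + s) := by
  obtain ⟨rS, CS, hrS, hCS, HS⟩ :=
    hS.entriesReduce.exists_lipschitz hS.localSmooth hpv.isOpen_points hK hKV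
  obtain ⟨rR, CR, hrR, hCR, HR⟩ :=
    hR.entriesReduce.exists_lipschitz hR.localSmooth hpv.isOpen_vectors hK' hKW
  obtain ⟨K₂, hK₂, hK₂W, HK₂⟩ :=
    hR.entriesReduce.exists_isCompact_image hR.localSmooth hRW hK' hKW
  obtain ⟨ra, Ca, hra, hCa, Ha⟩ := exists_lipschitz_near_compact (hK.prod hK₂)
    (hpv.isOpen_points.prod hpv.isOpen_vectors) (Set.prod_mono hKV hK₂W)
    (hpv.smooth_add.of_le one_le_two)
  refine ⟨min (min rS rR) (min (ra / (CS + 1)) (ra / (CR + 1))), Ca * (CS + CR),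
    lt_min (lt_min hrS hrR) (lt_min (by positivity) (by positivity)), by positivity, ?_⟩
  intro b b' d d' ε s hb hSb hd hε hεr hs hsr i
  have hε0 : 0 ≤ ε := (norm_nonneg _).trans (hε 0)
  have hs0 : 0 ≤ s := (norm_nonneg _).trans (hs 0)
  have h1 := (HS b b' hb ε (hεr.trans ((min_le_left _ _).trans (min_le_left _ _))) hε).2 i
  have h2 := (HR d d' hd s (hsr.trans ((min_le_left _ _).trans (min_le_right _ _))) hs).2 i
  have h3 : CS * ε ≤ ra := by
    have := hεr.trans ((min_le_right _ _).trans (min_le_left _ _))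
    rw [le_div_iff₀ (by positivity)] at this
    linarith
  have h4 : CR * s ≤ ra := by
    have := hsr.trans ((min_le_right _ _).trans (min_le_right _ _))
    rw [le_div_iff₀ (by positivity)] at this
    linarith
  have h5 := (Ha (S b i, R d i) ⟨hSb i, HK₂ d hd i⟩ (S b i, R d i) (S b' i, R d' i)
    (by simpa using hra.le) (by
      rw [norm_sub_rev, Prod.mk_sub_mk, Prod.norm_mk]
      exact max_le (h1.trans h3) (h2.trans h4))).2
  refine h5.trans ?_
  rw [mul_assoc, Prod.mk_sub_mk, Prod.norm_mk]
  refine mul_le_mul_of_nonneg_left (max_le (h1.trans ?_) (h2.trans ?_)) hCa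
  · have : 0 ≤ CS * s + CR * ε + CR * s := by positivity
    linarith
  · have : 0 ≤ CS * ε + CS * s + CR * ε := by positivity
    linarith

/-- One reconstruction step is close to the linearization of `S` if the data vary slowly and the
details are small. -/
theorem exists_fine_step (hpv : IsPointVectorPair V W add sub) (hS : IsUpscaling V S)
    (hR : IsUpscaling W R) (hRb : IsBoundedRule W R)
    {K : Set E} (hK : IsCompact K) (hKV : K ⊆ V) {K' : Set F} (hK' : IsCompact K')
    (hKW : K' ⊆ W) {T : (ℤ → E) → ℤ → E} {q : (ℤ → E) → ℝ} (hq : ∀ x, 0 ≤ q x)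
    (hT : LinearizedBy V K S T q) :
    ∃ r L : ℝ, 0 < r ∧ 0 ≤ L ∧ ∀ (b b' : ℤ → E) (d d' : ℤ → F) (η ε s : ℝ), ValuedIn K b →
      ValuedIn K (S b) → ValuedIn K' d → (∀ i, ‖fwdDiffSeq b i‖ ≤ η) → (∀ i, ‖d i‖ ≤ η) →
      η ≤ r → (∀ i, ‖(b - b') i‖ ≤ ε) → ε ≤ r → (∀ i, ‖(d - d') i‖ ≤ s) → s ≤ r →
      ∀ i, ‖(seqAdd add (S b) (R d) - seqAdd add (S b') (R d') - T (b - b')) i‖ ≤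
        L * (η + q (b - b')) * ε + L * s := by
  obtain ⟨rS, CS, hrS, hCS, HS⟩ :=
    hS.entriesReduce.exists_lipschitz hS.localSmooth hpv.isOpen_points hK hKV
  obtain ⟨rR, CR, hrR, hCR, HR⟩ :=
    hR.entriesReduce.exists_lipschitz hR.localSmooth hpv.isOpen_vectors hK' hKW
  obtain ⟨B, hB, HB⟩ := hRb.exists_le
  obtain ⟨ra, Ca, hra, hCa, Ha⟩ := hpv.exists_add_estimate hK hKV
  obtain ⟨rT, CT, hrT, hCT, HT⟩ := hT
  set r := min (min (min rS rR) rT) (min (ra / (CS + 1)) (ra / (2 * B + 1))) with hr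
  have hr1 : r ≤ rS := (min_le_left _ _).trans ((min_le_left _ _).trans (min_le_left _ _))
  have hr2 : r ≤ rR := (min_le_left _ _).trans ((min_le_left _ _).trans (min_le_right _ _))
  have hr3 : r ≤ rT := (min_le_left _ _).trans (min_le_right _ _)
  have hr4 : r * (CS + 1) ≤ ra := by
    rw [← le_div_iff₀ (by positivity)]
    exact (min_le_right _ _).trans (min_le_left _ _)
  have hr5 : r * (2 * B + 1) ≤ ra := by
    rw [← le_div_iff₀ (by positivity)]
    exact (min_le_right _ _).trans (min_le_right _ _)
  have hr0 : 0 < r := lt_min (lt_min (lt_min hrS hrR) hrT) (lt_min (by positivity) (by positivity))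
  refine ⟨r, Ca * (B * CS) + Ca * CR + CT, hr0, by positivity, ?_⟩
  intro b b' d d' η ε s hb hSb hd hη hdη hηr hε hεr hs hsr i
  have hε0 : 0 ≤ ε := (norm_nonneg _).trans (hε 0)
  have hη0 : 0 ≤ η := (norm_nonneg _).trans (hη 0)
  have hs0 : 0 ≤ s := (norm_nonneg _).trans (hs 0)
  obtain ⟨hb'V, h1⟩ := HS b b' hb ε (hεr.trans hr1) hε
  obtain ⟨hd'W, h2⟩ := HR d d' hd s (hsr.trans hr2) hs
  have h3 := HT b b' η ε hb hb'V hη (hηr.trans hr3) hε (hεr.trans hr3) i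
  have h4 := HB d (fun i => hKW (hd i)) η hdη i
  have h5 := HB d' hd'W (η + s) (fun i => by
    have e : d' i = d i - (d - d') i := by simp
    rw [e]
    exact (norm_sub_le _ _).trans (add_le_add (hdη i) (hs i))) i
  have hBr : B * (η + s) ≤ ra := by
    have : B * (η + s) ≤ B * (r + r) := mul_le_mul_of_nonneg_left (add_le_add hηr hsr) hB
    linarith
  have hBη : B * η ≤ B * (η + s) := mul_le_mul_of_nonneg_left (by linarith) hB
  have hSr : CS * ε ≤ ra := by
    have : CS * ε ≤ CS * r := mul_le_mul_of_nonneg_left hεr hCS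
    linarith
  have h6 := Ha (S b i) (hSb i) (S b' i) (R d i) (R d' i)
    (by rw [norm_sub_rev]; exact (h1 i).trans hSr) (h4.trans (hBη.trans hBr)) (h5.trans hBr)
  -- The deviation from `T` splits into the error of treating `⊕` as a translation and the error of
  -- linearizing `S`.
  have e : (seqAdd add (S b) (R d) - seqAdd add (S b') (R d') - T (b - b')) i =
      (add (S b i) (R d i) - add (S b' i) (R d' i) - (S b i - S b' i)) +
        (S b i - S b' i - T (b - b') i) := by
    simp only [seqAdd, Pi.sub_apply]; abel
  rw [e]
  have h7 : ‖R d i‖ * ‖S b i - S b' i‖ ≤ B * η * (CS * ε) :=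
    mul_le_mul h4 (h1 i) (norm_nonneg _) (by positivity)
  have h8 : Ca * (‖R d i‖ * ‖S b i - S b' i‖ + ‖R d i - R d' i‖) ≤
      Ca * (B * η * (CS * ε) + CR * s) :=
    mul_le_mul_of_nonneg_left (add_le_add h7 (h2 i)) hCa
  refine (norm_add_le _ _).trans ((add_le_add (h6.trans h8) h3).trans ?_)
  have hq0 := hq (b - b')
  have k1 : 0 ≤ Ca * (B * CS) * q (b - b') * ε := by positivity
  have k2 : 0 ≤ Ca * CR * (η + q (b - b')) * ε := by positivity
  have k3 : 0 ≤ (Ca * (B * CS) + CT) * s := by positivity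
  linarith

end Steps

/-- Details are bounded by the differences of the data. -/
theorem exists_detail_estimate {E F : Type*} [NormedAddCommGroup E] [NormedSpace ℝ E]
    [FiniteDimensional ℝ E] [NormedAddCommGroup F] [NormedSpace ℝ F]
    {V : Set E} {W : Set F} {add : E → F → E} {sub : E → E → F}
    {S D : (ℤ → E) → ℤ → E} {Q : (ℤ → F) → ℤ → F} (hpv : IsPointVectorPair V W add sub) (hS : IsUpscaling V S)
    (hD : IsDownscaling V D) (hSc : ReproducesConstants V S) (hDc : ReproducesConstants V D)
    (hQb : IsBoundedRule W Q) {K : Set E} (hK : IsCompact K) (hKV : K ⊆ V) :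
    ∃ r C : ℝ, 0 < r ∧ 0 ≤ C ∧ ∀ c : ℤ → E, ValuedIn K c → ValuedIn V (D c) →
      ValuedIn V (S (D c)) → ∀ η ≤ r, (∀ i, ‖fwdDiffSeq c i‖ ≤ η) →
      ∀ k, ‖detail sub S D Q c k‖ ≤ C * η := by
  obtain ⟨r, C, hr, hC, H⟩ := exists_prediction_estimate hpv.isOpen_points hS hD hSc hDc hK hKV
  obtain ⟨CQ, hCQ, HQ⟩ := hQb.exists_le
  obtain ⟨A, B, _, hAB⟩ := hpv.lipschitz
  refine ⟨r, CQ * (|B| * C), hr, by positivity, fun c hc hDV hSV η hη hΔ k => ?_⟩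
  have h1 := HQ (seqSub sub c (S (D c))) (fun i => hpv.sub_mem _ (hSV i) _ (hKV (hc i)))
    (|B| * (C * η)) (fun i => by
      refine (hAB _ (hKV (hc i)) _ (hSV i)).2.trans ?_
      refine mul_le_mul (le_abs_self B) ?_ (norm_nonneg _) (abs_nonneg B)
      exact H c hc hDV η hη hΔ i) k
  exact h1.trans (le_of_eq (by ring))

/-! ### Assembly of the stability estimate. -/

section Stability

variable {E F : Type*} [NormedAddCommGroup E] [NormedSpace ℝ E] [FiniteDimensional ℝ E]
  [NormedAddCommGroup F] [NormedSpace ℝ F] [FiniteDimensional ℝ F]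
  {V : Set E} {W : Set F} {add : E → F → E} {sub : E → E → F}
  {S D : (ℤ → E) → ℤ → E} {Q R : (ℤ → F) → ℤ → F}

theorem exists_stability_constants [Nontrivial E] (hpv : IsPointVectorPair V W add sub)
    (hS : IsUpscaling V S) (hD : IsDownscaling V D) (hQ : IsDownscaling W Q)
    (hR : IsUpscaling W R)
    (hQW : ∀ w, ValuedIn W w → ValuedIn W (Q w)) (hRW : ∀ w, ValuedIn W w → ValuedIn W (R w))
    (hqmf : IsQMF V add sub S D Q R) (hQb : IsBoundedRule W Q) (hRb : IsBoundedRule W R)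
    (hSc : ReproducesConstants V S) (hDc : ReproducesConstants V D)
    (hSlin : (∃ α : ℤ →₀ ℝ, IsConvergentSubdivision α ∧
        ∀ x ∈ V, HasSeqDifferentialAt S (upscale α) (fun _ => x)) ∨ IsSplittingRule V S)
    (c : ℕ → ℤ → E) (K : Set E) (hK : IsCompact K) (hKV : K ⊆ V)
    (hcK : ∀ j, ValuedIn K (c j)) (hScK : ∀ j, ValuedIn K (S (c j)))
    (hcD : ∀ j, c j = D (c (j + 1))) {μ Cd : ℝ} (hμ0 : 0 ≤ μ) (hμ1 : μ < 1) (hCd : 0 ≤ Cd)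
    (hdecay : ∀ j i, ‖fwdDiffSeq (c j) i‖ ≤ Cd * μ ^ j) :
    ∃ M E₁ E₂ : ℝ, 0 ≤ M ∧ 0 < E₁ ∧ 0 < E₂ ∧
      ∀ (j : ℕ) (c' : ℕ → ℤ → E) (d' : ℕ → ℤ → F) (s : ℕ → ℝ) (x : ℝ),
        (∀ k < j, c' (k + 1) = seqAdd add (S (c' k)) (R (d' (k + 1)))) →
        (∀ i, ‖(c 0 - c' 0) i‖ ≤ x) → x ≤ E₁ → (∀ k, 0 ≤ s k) →
        (∀ k < j, (∀ i, ‖(detail sub S D Q (c (k + 1)) - d' (k + 1)) i‖ ≤ s k) ∧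
          s k ≤ E₂ * μ ^ k) →
        ∀ i, ‖(c j - c' j) i‖ ≤ M * (x + ∑ k ∈ Finset.range j, s k) := by
  obtain ⟨T, p, q, C, γ, hpq, hT⟩ :=
    exists_adapted_linearization hpv.isOpen_points hS hSc hSlin hK hKV ⟨_, hcK 0 0⟩
  -- Data and predictions lie in `K`, so their `⊖`-differences, and after `Q` the details, lie in a
  -- compact part of `W`.
  have hK₁ : IsCompact ((fun x : E × E => sub x.1 x.2) '' K ×ˢ K) :=
    (hK.prod hK).image_of_continuousOn (hpv.smooth_sub.continuousOn.mono (Set.prod_mono hKV hKV))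
  have hK₁W : (fun x : E × E => sub x.1 x.2) '' K ×ˢ K ⊆ W := by
    rintro _ ⟨⟨x, y⟩, ⟨hx, hy⟩, rfl⟩
    exact hpv.sub_mem _ (hKV hy) _ (hKV hx)
  obtain ⟨K₂, hK₂, hK₂W, HK₂⟩ :=
    hQ.entriesReduce.exists_isCompact_image hQ.localSmooth hQW hK₁ hK₁W
  have hd : ∀ k, ValuedIn K₂ (detail sub S D Q (c (k + 1))) := fun k => HK₂ _ fun i => by
    rw [← hcD]
    exact ⟨(c (k + 1) i, S (c k) i), ⟨hcK _ i, hScK _ i⟩, rfl⟩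
  have hrec : ∀ k, c (k + 1) = seqAdd add (S (c k)) (R (detail sub S D Q (c (k + 1)))) :=
    fun k => by
      have := hqmf (c (k + 1)) (fun i => hKV (hcK _ i))
        (by rw [← hcD]; exact fun i => hKV (hcK _ i))
        (by rw [← hcD]; exact fun i => hKV (hScK _ i))
      rw [detail]
      nth_rewrite 1 [← this]
      rw [← hcD]
  obtain ⟨rc, Lc, hrc, hLc, Hc⟩ := exists_coarse_step hpv hS hR hRW hK hKV hK₂ hK₂W
  obtain ⟨rf, Lf, hrf, hLf, Hf⟩ :=
    exists_fine_step hpv hS hR hRb hK hKV hK₂ hK₂W hpq.q_nonneg hT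
  obtain ⟨rd, Cq, hrd, hCq, Hd⟩ := exists_detail_estimate hpv hS hD hSc hDc hQb hK hKV
  -- `B * μ ^ k` bounds the differences of `c k` and the details of level `k + 1` at once; from
  -- level `J` on it lies within reach of the fine step.
  set B := max 1 (max Cd (Cq * Cd)) with hB
  have hB1 : 1 ≤ B := le_max_left _ _
  have hsmall : ∀ᶠ J : ℕ in atTop, μ ^ J < min (rd / (Cd + 1)) (rf / B) :=
    (tendsto_pow_atTop_nhds_zero_of_lt_one hμ0 hμ1).eventually_lt_const
      (lt_min (by positivity) (by positivity))
  obtain ⟨J, hJ⟩ := hsmall.exists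
  obtain ⟨M, E₁, E₂, hM, hE₁, hE₂, H⟩ := stable_of_steps hpq (r := min rc rf)
    (L := Lc + Lf * B) (lt_min hrc hrf) (by positivity) hμ0 hμ1 J
  refine ⟨M, E₁, E₂, hM, hE₁, hE₂, fun j c' d' s x hc' hx hxE hs hds => ?_⟩
  refine H j (fun k => c k - c' k) s x hx hxE hs (fun k hk => (hds k hk).2) ?_ ?_
  · intro k hk ε hε hke hsk i
    rw [hrec k, hc' k hk]
    refine (Hc (c k) (c' k) _ _ ε (s k) (hcK k) (hScK k) (hd k) hke
      (hε.trans (min_le_left _ _)) (hds k hk).1 (hsk.trans (min_le_left _ _)) i).trans ?_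
    refine mul_le_mul_of_nonneg_right ?_ (add_nonneg ((norm_nonneg _).trans (hke 0)) (hs k))
    have : 0 ≤ Lf * B := by positivity
    linarith
  · intro k hk hJk ε hε hke hsk i
    have hε0 : 0 ≤ ε := (norm_nonneg _).trans (hke 0)
    have hμk0 : 0 ≤ μ ^ k := pow_nonneg hμ0 k
    have hμk : μ ^ k ≤ μ ^ J := pow_le_pow_of_le_one hμ0 hμ1.le hJk
    have hμk' : μ ^ (k + 1) ≤ μ ^ k := pow_le_pow_of_le_one hμ0 hμ1.le (Nat.le_succ k)
    have h1 : Cd * μ ^ (k + 1) ≤ rd := by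
      have h := (hμk.trans hJ.le).trans (min_le_left _ _)
      rw [le_div_iff₀ (by positivity)] at h
      have : Cd * μ ^ (k + 1) ≤ Cd * μ ^ k := mul_le_mul_of_nonneg_left hμk' hCd
      linarith
    have h2 : B * μ ^ k ≤ rf := by
      have h := (hμk.trans hJ.le).trans (min_le_right _ _)
      rw [le_div_iff₀ (by positivity)] at h
      linarith
    have h3 : ∀ i, ‖detail sub S D Q (c (k + 1)) i‖ ≤ B * μ ^ k := fun i => by
      refine (Hd (c (k + 1)) (hcK _) (by rw [← hcD]; exact fun i => hKV (hcK _ i))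
        (by rw [← hcD]; exact fun i => hKV (hScK _ i)) _ h1 (hdecay (k + 1)) i).trans ?_
      rw [← mul_assoc]
      exact mul_le_mul ((le_max_right _ _).trans (le_max_right _ _)) hμk' (by positivity)
        (by positivity)
    have h4 : ∀ i, ‖fwdDiffSeq (c k) i‖ ≤ B * μ ^ k := fun i => (hdecay k i).trans
      (mul_le_mul_of_nonneg_right ((le_max_left _ _).trans (le_max_right _ _)) hμk0)
    have h5 := Hf (c k) (c' k) (detail sub S D Q (c (k + 1))) (d' (k + 1)) (B * μ ^ k) ε (s k)
      (hcK k) (hScK k) (hd k) h4 h3 h2 hke (hε.trans (min_le_right _ _)) (hds k hk).1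
      (hsk.trans (min_le_right _ _)) i
    rw [← hrec k, ← hc' k hk] at h5
    refine h5.trans (add_le_add (mul_le_mul_of_nonneg_right ?_ hε0)
      (mul_le_mul_of_nonneg_right ?_ (hs k)))
    · have hq0 := hpq.q_nonneg (c k - c' k)
      have k1 : q (c k - c' k) ≤ B * q (c k - c' k) := le_mul_of_one_le_left hq0 hB1
      have k2 : Lf * (B * μ ^ k + q (c k - c' k)) ≤ Lf * (B * μ ^ k + B * q (c k - c' k)) :=
        mul_le_mul_of_nonneg_left (by linarith) hLf
      have k3 : 0 ≤ Lc * (μ ^ k + q (c k - c' k)) := by positivity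
      linarith
    · have : Lf ≤ Lf * B := le_mul_of_one_le_right hLf hB1
      linarith

end Stability

end Multiscale

theorem mainTheorem1
    {E F : Type*} [NormedAddCommGroup E] [NormedSpace ℝ E] [FiniteDimensional ℝ E]
    [NormedAddCommGroup F] [NormedSpace ℝ F] [FiniteDimensional ℝ F]
    (V : Set E) (W : Set F) (add : E → F → E) (sub : E → E → F)
    (hpv : Multiscale.IsPointVectorPair V W add sub)
    (S D : (ℤ → E) → ℤ → E) (Q R : (ℤ → F) → ℤ → F)
    -- smooth, local, shift-equivariant up- and downscaling operators
    (hS : Multiscale.IsUpscaling V S) (hD : Multiscale.IsDownscaling V D)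
    (hQ : Multiscale.IsDownscaling W Q) (hR : Multiscale.IsUpscaling W R)
    (hQW : ∀ w, Multiscale.ValuedIn W w → Multiscale.ValuedIn W (Q w))
    (hRW : ∀ w, Multiscale.ValuedIn W w → Multiscale.ValuedIn W (R w))
    (hqmf : Multiscale.IsQMF V add sub S D Q R)
    (hQb : Multiscale.IsBoundedRule W Q) (hRb : Multiscale.IsBoundedRule W R)
    (hSc : Multiscale.ReproducesConstants V S) (hDc : Multiscale.ReproducesConstants V D)
    -- first-order linearity on constant data, or the Haar case
    (hSlin : (∃ α : ℤ →₀ ℝ, Multiscale.IsConvergentSubdivision α ∧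
        ∀ x ∈ V, Multiscale.HasSeqDifferentialAt S (Multiscale.upscale α) (fun _ => x)) ∨
      Multiscale.IsSplittingRule V S)
    (hDlin : ∃ β : ℤ →₀ ℝ,
        ∀ x ∈ V, Multiscale.HasSeqDifferentialAt D (Multiscale.downscale β) (fun _ => x))
    -- the data pyramid, with data and predictions in a compact part of the chart
    (c : ℕ → ℤ → E) (K : Set E) (hK : IsCompact K) (hKV : K ⊆ V)
    (hcK : ∀ j, Multiscale.ValuedIn K (c j)) (hScK : ∀ j, Multiscale.ValuedIn K (S (c j)))
    (hcD : ∀ j, c j = D (c (j + 1)))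
    (μ : ℝ≥0) (hμ : μ < 1)
    (hdecay : ∃ C : ℝ≥0, ∀ j : ℕ, Multiscale.seqNorm (Multiscale.fwdDiffSeq (c j)) ≤ C * (μ : ℝ≥0∞) ^ j) :
    ∃ M E₁ E₂ : ℝ≥0, 0 < E₁ ∧ 0 < E₂ ∧
      ∀ (j : ℕ) (c' : ℕ → ℤ → E) (d' : ℕ → ℤ → F),
        (∀ k < j, c' (k + 1) = Multiscale.seqAdd add (S (c' k)) (R (d' (k + 1)))) →
        Multiscale.seqNorm (c 0 - c' 0) ≤ E₁ →
        (∀ k ∈ Finset.Icc 1 j,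
          Multiscale.seqNorm (Multiscale.detail sub S D Q (c k) - d' k) ≤ E₂ * (μ : ℝ≥0∞) ^ k) →
        Multiscale.seqNorm (c j - c' j) ≤
          M * (Multiscale.seqNorm (c 0 - c' 0) +
            ∑ k ∈ Finset.Icc 1 j,
              Multiscale.seqNorm (Multiscale.detail sub S D Q (c k) - d' k)) := by
  obtain ⟨Cd, hCd⟩ := hdecay
  -- In the zero space all errors vanish; otherwise there is a nonzero vector, as required to see
  -- that `S_α` reproduces the scalar constant `1`.
  rcases subsingleton_or_nontrivial E with hE | hE
  · refine ⟨0, 1, 1, one_pos, one_pos, fun j c' d' _ _ _ => ?_⟩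
    refine (iSup_le (a := 0) fun i => ?_).trans zero_le
    rw [Subsingleton.elim ((c j - c' j) i) 0, enorm_zero]
  have hdec : ∀ j i, ‖Multiscale.fwdDiffSeq (c j) i‖ ≤ (Cd : ℝ) * (μ : ℝ) ^ j := fun j =>
    (Multiscale.seqNorm_le_ofReal_iff (by positivity)).1 ((hCd j).trans (by
      rw [ENNReal.ofReal_mul Cd.coe_nonneg, ENNReal.ofReal_pow μ.coe_nonneg,
        ENNReal.ofReal_coe_nnreal, ENNReal.ofReal_coe_nnreal]))
  obtain ⟨M, E₁, E₂, hM, hE₁, hE₂, H⟩ := Multiscale.exists_stability_constants hpv hS hD hQ hR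
    hQW hRW hqmf hQb hRb hSc hDc hSlin c K hK hKV hcK hScK hcD μ.coe_nonneg
    (by exact_mod_cast hμ) Cd.coe_nonneg hdec
  refine ⟨M.toNNReal, E₁.toNNReal, E₂.toNNReal, Real.toNNReal_pos.2 hE₁, Real.toNNReal_pos.2 hE₂,
    fun j c' d' hc' h0 hd => ?_⟩
  have h0' : Multiscale.seqNorm (c 0 - c' 0) ≠ ∞ := ne_top_of_le_ne_top ENNReal.coe_ne_top h0
  -- Details are reindexed from level `k + 1` to step `k`; since `μ ≤ 1`, a bound by `μ ^ (k + 1)`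
  -- gives one by `μ ^ k`.
  have hdk : ∀ k < j, Multiscale.seqNorm
      (Multiscale.detail sub S D Q (c (k + 1)) - d' (k + 1)) ≤
        ENNReal.ofReal (E₂ * (μ : ℝ) ^ k) := by
    intro k hk
    refine (hd (k + 1) (Finset.mem_Icc.2 ⟨by omega, by omega⟩)).trans ?_
    rw [ENNReal.ofReal_mul hE₂.le, ENNReal.ofReal_pow μ.coe_nonneg, ENNReal.ofReal_coe_nnreal]
    refine mul_le_mul_right (pow_le_pow_right_of_le_one' ?_ (Nat.le_succ k)) _
    exact_mod_cast hμ.le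
  set s : ℕ → ℝ := fun k => (Multiscale.seqNorm
    (Multiscale.detail sub S D Q (c (k + 1)) - d' (k + 1))).toReal
  have hfin := H j c' d' s (Multiscale.seqNorm (c 0 - c' 0)).toReal hc'
    (Multiscale.norm_le_toReal_seqNorm h0') (by
      have := ENNReal.toReal_mono ENNReal.coe_ne_top h0
      rwa [ENNReal.coe_toReal, Real.coe_toNNReal _ hE₁.le] at this)
    (fun k => ENNReal.toReal_nonneg)
    (fun k hk => ⟨Multiscale.norm_le_toReal_seqNorm
      (ne_top_of_le_ne_top ENNReal.ofReal_ne_top (hdk k hk)),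
      ENNReal.toReal_le_of_le_ofReal (by positivity) (hdk k hk)⟩)
  have hsum0 : 0 ≤ ∑ k ∈ Finset.range j, s k :=
    Finset.sum_nonneg fun k _ => ENNReal.toReal_nonneg
  have hsum : ∑ k ∈ Finset.Icc 1 j,
      Multiscale.seqNorm (Multiscale.detail sub S D Q (c k) - d' k) =
        ENNReal.ofReal (∑ k ∈ Finset.range j, s k) := by
    rw [ENNReal.ofReal_sum_of_nonneg fun k _ => ENNReal.toReal_nonneg,
      Finset.range_eq_Ico, ← Finset.Ico_add_one_right_eq_Icc, ← Finset.sum_Ico_add' _ 0 j 1]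
    refine Finset.sum_congr rfl fun k hk => ?_
    rw [ENNReal.ofReal_toReal
      (ne_top_of_le_ne_top ENNReal.ofReal_ne_top (hdk k (Finset.mem_Ico.1 hk).2))]
  refine ((Multiscale.seqNorm_le_ofReal_iff (mul_nonneg hM
    (add_nonneg ENNReal.toReal_nonneg hsum0))).2 hfin).trans (le_of_eq ?_)
  rw [ENNReal.ofReal_mul hM, ENNReal.ofReal_add ENNReal.toReal_nonneg hsum0,
    ENNReal.ofReal_toReal h0', ← hsum]
  rfl
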